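/- **Setting.** Logarithms are to base 2, $H(u)=-u\log u-(1-u)\log(1-u)$, $D_{KL}(u\|p)=u\log\frac{u}{p}+(1-u)\log\frac{1-u}{1-p}$ (with $0\log 0=0$) and $[x]^+=\max(x,0)$. For each block length $N$, a word $c=(c_1,\dots,c_N)$ over a finite field $\mathbb F_m$ ($m=m_N$ may depend on $N$) is sent over the memoryless $m$-ary symmetric channel, $\Pr(r\mid c)=p$ if $r=c$ and $(1-p)/(m-1)$ otherwise, where $(1-p)/(m-1)<p<1$. The error pattern $x^N\in\{0,1\}^N$ has $x_i=1$ if the hard decision at position $i$ (the most likely symbol given $r_i$) equals $c_i$, and $x_i=0$ otherwise. In mBM-1 one chooses a set $\mathcal B_N\subseteq\{0,1\}^N$ of erasure patterns ($\hat x_i=0$: erase position $i$; $\hat x_i=1$: use the hard decision) and makes one errors-and-erasures decoding attempt per pattern, so that $|\mathcal B_N|$ is the number of decoding attempts. With $\delta(0,0)=\delta(1,0)=1$, $\delta(0,1)=2$, $\delta(1,1)=0$ and $d(x^N,\hat x^N)=\sum_i\delta(x_i,\hat x_i)$, let $$p_e(\mathcal B_N)=\Pr\Big(\min_{\hat x^N\in\mathcal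 B_N}d(x^N,\hat x^N)>D_N\Big)$$ (equal to $1$ if $\mathcal B_N=\emptyset$), where the thresholds $D_N\in\mathbb R$ satisfy $D_N/N\to\bar D$ with $1-p<\bar D\le 1$. A sequence $(\mathcal B_N)$ *achieves the exponent* $\bar F$ per symbol (total exponent $F=N\bar F$) if $p_e(\mathcal B_N)\to0$ and $\liminf_{N\to\infty}-\frac1N\log p_e(\mathcal B_N)\ge\bar F$. **Theorem 2 (minimum number of decoding attempts).** The function $g(u)=D_{KL}(u\|p)$ maps $[1-\bar D,p]$ bijectively onto $[0,D_{KL}(1-\bar D\|p)]$; let $g^{-1}$ be its inverse. Let $\bar F\in[0,D_{KL}(1-\bar D\|p)]$ and $$\bar R=\big[H(g^{-1}(\bar F))-H(g^{-1}(\bar F)+\bar D-1)\big]^+ .$$ Then the minimum number of decoding attempts with which mBM-1 achieves the exponent $\bar F$ is $2^{N\bar R}$ to first order in the exponent: 1. there are sets $\mathcal B_N$, not depending on the transmitted words, that achieve the exponent $\bar F$ for every sequence of transmitted words and satisfy, for every $\varepsilon>0$, $|\mathcal B_N|\le 2^{N(\bar R+\varepsilon)}$ for all sufficiently large $N$; 2.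 whenever sets $\mathcal B_N$ achieve the exponent $\bar F$ for some sequence of transmitted words, then for every $\varepsilon>0$, $|\mathcal B_N|\ge 2^{N(\bar R-\varepsilon)}$ for all sufficiently large $N$. -/

import Mathlib

open Filter Topology

noncomputable section

namespace MBM

/-- Binary entropy, in bits (`0 log 0 = 0`). -/
def H (u : ℝ) : ℝ := -u * Real.logb 2 u - (1 - u) * Real.logb 2 (1 - u)

/-- Binary Kullback-Leibler divergence `D_KL(u‖p)`, in bits, used for `u ∈ [0,1]`, `p ∈ (0,1)`. -/
def klBin (u p : ℝ) : ℝ :=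
  u * Real.logb 2 (u / p) + (1 - u) * Real.logb 2 ((1 - u) / (1 - p))

/-- The inverse of `u ↦ D_KL(u‖p)` on `[1 - D, p]`. -/
def gInv (D p : ℝ) : ℝ → ℝ :=
  Function.invFunOn (fun u => klBin u p) (Set.Icc (1 - D) p)

/-- Rate per symbol `[H(u) - H(u + D - 1)]⁺` at `u = g⁻¹(E)`, where `D` and `E` are the
distortion and the exponent per symbol. -/
def rate (D p E : ℝ) : ℝ := max (H (gInv D p E) - H (gInv D p E + D - 1)) 0

/-- Transition probability `Pr(r | c)` of the `m`-ary symmetric channel on the alphabet `A`,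
`m = |A|`: input `c`, output `r`. -/
def symmChannel {A : Type*} [Fintype A] [DecidableEq A] (p : ℝ) (c r : A) : ℝ :=
  if r = c then p else (1 - p) / ((Fintype.card A : ℝ) - 1)

/-- `a` is the (strictly) most likely input symbol given the channel output `r`. -/
def IsHardDecision {A : Type*} [Fintype A] [DecidableEq A] (p : ℝ) (r a : A) : Prop :=
  ∀ b, b ≠ a → symmChannel p b r < symmChannel p a r

open Classical in
/-- Error pattern: letter `1` where the hard decision is the transmitted symbol, `0` where it is
not. -/
def errorPattern {A : Type*} [Fintype A] [DecidableEq A] (p : ℝ) {N : ℕ} (c r : Fin N → A) :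
    Fin N → Fin 2 :=
  fun i => if IsHardDecision p (r i) (c i) then 1 else 0

/-- Letter distortion of mBM-1: the first argument is the error letter, the second the erasure
letter (`0` = erase, `1` = use the hard decision). -/
def letterDist : Fin 2 → Fin 2 → ℕ
  | 0, 0 => 1
  | 0, 1 => 2
  | 1, 0 => 1
  | 1, 1 => 0

/-- Distortion between an error pattern and an erasure pattern; it equals `2 v + e`, with `e` the
number of erasures and `v` the number of errors in unerased positions. -/
def dist {N : ℕ} (x y : Fin N → Fin 2) : ℕ := ∑ i, letterDist (x i) (y i)

open Classical in
/-- `p_e = Pr(min_{y ∈ B} d(x, y) > D)`: the probability, when the word `c` is sent over the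
memoryless symmetric channel, that every attempt with an erasure pattern in `B` has distortion
greater than `D`. -/
def errorProb {A : Type*} [Fintype A] [DecidableEq A] (p : ℝ) {N : ℕ} (c : Fin N → A)
    (B : Finset (Fin N → Fin 2)) (D : ℝ) : ℝ :=
  ∑ r : Fin N → A, if ∀ y ∈ B, D < (dist (errorPattern p c r) y : ℝ)
    then ∏ i, symmChannel p (c i) (r i) else 0

/-- The error probabilities tend to `0`, with exponent at least `E` per symbol:
`liminf (-(1/N) log₂ (pe N)) ≥ E` (the exponent is infinite where `pe N = 0`). -/
def AchievesExponent (pe : ℕ → ℝ) (E : ℝ) : Prop :=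
  Tendsto pe atTop (𝓝 0) ∧
    ∀ ε : ℝ, 0 < ε → ∀ᶠ N : ℕ in atTop, pe N ≤ (2 : ℝ) ^ (-((N : ℝ) * (E - ε)))

end MBM

end

noncomputable section

namespace MBM

/-! An error pattern `x` is identified with its set of correct positions, whose size is binomial
with parameter `p`. By `dist_add_card_ones`, `dist x y + |x| = N + |x ∆ y|`. Hence, for `x` of
weight about `uN`, distortion at most `DN` means Hamming distance at most about `sN`, where `s = u +
D - 1`. The question becomes how many Hamming balls cover the weight shells that matter, and the
exponent `E` says which ones do: those of relative weight at least `u = g⁻¹(E)`.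

Sufficiency. The distortion equals `N + |y| - 2 |x ∩ y|`, so it can only drop when `x` grows, and a
family that covers one shell near `uN` covers all heavier ones. A greedy choice
(`exists_overlap_cover`) is as good as random coding. `exists_overlap_parameters` picks the weight
and the overlap of the code words so that its size is `2 ^ (N [H(u) - H(s)]⁺)` to first order. What
stays uncovered is a lower binomial tail, bounded by Chernoff (`sum_binomial_le`), or by Chebyshev
when `u = p`, where only convergence to `0` is at stake.

Necessity. A ball of radius `sN` has at most `2 ^ (N H(s))` elements, while a shell near `uN` has
about `2 ^ (N H(u))`. With too few patterns, half of each such shell is uncovered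
(`exists_half_uncovered`). If `u < p`, a shell slightly above `u` alone has probability of exponent
below `E`. If `u = p`, the shells near `p` carry most of the mass, and the error probability stays
above `1/4`. -/

/-! ### Binary entropy and divergence -/

lemma H_eq_binEntropy_div (u : ℝ) : H u = Real.binEntropy u / Real.log 2 := by
  simp only [H, Real.logb, Real.binEntropy_eq_negMulLog_add_negMulLog_one_sub, Real.negMulLog]
  ring

lemma H_continuous : Continuous H := by
  have : H = fun u => Real.binEntropy u / Real.log 2 := funext H_eq_binEntropy_div
  rw [this]
  exact Real.binEntropy_continuous.div_const _

/-- Separating the logarithms of the ratios leaves an affine function minus the entropy, so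
continuity and derivatives come from `Real.binEntropy`. The endpoints `u = 0, 1` are included
because `Real.log 0 = 0`. -/
lemma klBin_eq_neg_binEntropy {p : ℝ} (h0 : 0 < p) (h1 : p < 1) (u : ℝ) :
    klBin u p =
      (-Real.binEntropy u - u * Real.log p - (1 - u) * Real.log (1 - p)) / Real.log 2 := by
  have key : ∀ x q : ℝ, 0 < q →
      x * Real.logb 2 (x / q) = (x * Real.log x - x * Real.log q) / Real.log 2 := by
    intro x q hq
    rcases eq_or_ne x 0 with rfl | hx
    · simp
    · rw [Real.logb, Real.log_div hx hq.ne']; ring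
  rw [klBin, key _ _ h0, key _ _ (by linarith),
    Real.binEntropy_eq_negMulLog_add_negMulLog_one_sub, Real.negMulLog, Real.negMulLog]
  ring

lemma klBin_continuous {p : ℝ} (h0 : 0 < p) (h1 : p < 1) : Continuous fun u => klBin u p := by
  simp only [klBin_eq_neg_binEntropy h0 h1]
  fun_prop

lemma klBin_self {p : ℝ} (h0 : 0 < p) (h1 : p < 1) : klBin p p = 0 := by
  have : (1 - p) ≠ 0 := by linarith
  simp [klBin, h0.ne', this]

lemma klBin_strictAntiOn {p : ℝ} (h0 : 0 < p) (h1 : p < 1) :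
    StrictAntiOn (fun u => klBin u p) (Set.Icc 0 p) := by
  apply strictAntiOn_of_deriv_neg (convex_Icc 0 p) (klBin_continuous h0 h1).continuousOn
  intro u hu
  rw [interior_Icc] at hu
  have hlog2 : 0 < Real.log 2 := Real.log_pos one_lt_two
  have hu1 : u < 1 := hu.2.trans h1
  have hd : HasDerivAt (fun u => klBin u p)
      ((-(Real.log (1 - u) - Real.log u) - 1 * Real.log p - (-1) * Real.log (1 - p))
        / Real.log 2) u := by
    simp only [klBin_eq_neg_binEntropy h0 h1]
    refine HasDerivAt.div_const (HasDerivAt.sub (HasDerivAt.sub ?_ ?_) ?_) _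
    · exact (Real.hasDerivAt_binEntropy hu.1.ne' hu1.ne).neg
    · exact (hasDerivAt_id u).mul_const _
    · exact ((hasDerivAt_id u).const_sub 1).mul_const _
  rw [hd.deriv]
  apply div_neg_of_neg_of_pos _ hlog2
  have a := Real.log_lt_log hu.1 hu.2
  have b := Real.log_lt_log (by linarith : (0 : ℝ) < 1 - p) (by linarith [hu.2] : 1 - p < 1 - u)
  linarith

lemma klBin_bijOn {p D : ℝ} (h0 : 0 < p) (h1 : p < 1) (hD0 : 1 - p < D) (hD1 : D ≤ 1) :
    Set.BijOn (fun u => klBin u p) (Set.Icc (1 - D) p) (Set.Icc 0 (klBin (1 - D) p)) := by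
  have hsub : Set.Icc (1 - D) p ⊆ Set.Icc 0 p := Set.Icc_subset_Icc_left (by linarith)
  have hanti := (klBin_strictAntiOn h0 h1).mono hsub
  have hle : 1 - D ≤ p := by linarith
  refine ⟨?_, hanti.injOn, ?_⟩
  · intro u hu
    refine ⟨?_, hanti.antitoneOn (Set.left_mem_Icc.2 hle) hu hu.1⟩
    rw [← klBin_self h0 h1]
    exact hanti.antitoneOn hu (Set.right_mem_Icc.2 hle) hu.2
  · have := intermediate_value_Icc' hle (klBin_continuous h0 h1).continuousOn
    simp only [klBin_self h0 h1] at this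
    exact this

lemma gInv_mem {p D E : ℝ} (h0 : 0 < p) (h1 : p < 1) (hD0 : 1 - p < D) (hD1 : D ≤ 1)
    (hE : E ∈ Set.Icc 0 (klBin (1 - D) p)) : gInv D p E ∈ Set.Icc (1 - D) p :=
  Function.invFunOn_mem ((klBin_bijOn h0 h1 hD0 hD1).surjOn hE)

lemma klBin_gInv {p D E : ℝ} (h0 : 0 < p) (h1 : p < 1) (hD0 : 1 - p < D) (hD1 : D ≤ 1)
    (hE : E ∈ Set.Icc 0 (klBin (1 - D) p)) : klBin (gInv D p E) p = E :=
  Function.invFunOn_eq (f := fun u => klBin u p) ((klBin_bijOn h0 h1 hD0 hD1).surjOn hE)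

/-! ### Binomial coefficients to first order in the exponent -/

-- The weights `m ^ i / i!` of the Poisson law with mean `m` are maximal at `i = m`. Two such
-- inequalities multiply to the statement about the binomial mode.
open Nat in
lemma factorial_mul_pow_le (m i : ℕ) : m ! * m ^ i ≤ i ! * m ^ m := by
  rcases le_total m i with h | h
  · calc m ! * m ^ i = (m ! * m ^ (i - m)) * m ^ m := by
          rw [mul_assoc, ← pow_add, Nat.sub_add_cancel h]
      _ ≤ i ! * m ^ m := Nat.mul_le_mul_right _ (Nat.factorial_mul_pow_sub_le_factorial h)
  · have e := Nat.factorial_mul_descFactorial (Nat.sub_le m i)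
    rw [Nat.sub_sub_self h] at e
    calc m ! * m ^ i = i ! * m.descFactorial (m - i) * m ^ i := by rw [e]
      _ ≤ i ! * m ^ (m - i) * m ^ i := by
          gcongr; exact Nat.descFactorial_le_pow _ _
      _ = i ! * m ^ m := by rw [mul_assoc, ← pow_add, Nat.sub_add_cancel h]

/-- The binomial distribution with parameters `m + l` and `m / (m + l)` has its mode at `m`. -/
lemma choose_mul_pow_le_mode (m l i : ℕ) (hi : i ≤ m + l) :
    (m + l).choose i * m ^ i * l ^ (m + l - i) ≤ (m + l).choose m * m ^ m * l ^ l := by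
  have h1 := factorial_mul_pow_le m i
  have h2 := factorial_mul_pow_le l (m + l - i)
  have e1 := Nat.choose_mul_factorial_mul_factorial hi
  have e2 := Nat.add_choose_mul_factorial_mul_factorial m l
  rw [← Nat.choose_symm_add] at e2
  have e3 : 0 < (m.factorial * l.factorial) * (i.factorial * (m + l - i).factorial) := by positivity
  refine Nat.le_of_mul_le_mul_right ?_ e3
  calc _ = ((m + l).choose i * i.factorial * (m + l - i).factorial) *
        ((m.factorial * m ^ i) * (l.factorial * l ^ (m + l - i))) := by ring
    _ ≤ (m + l).factorial *
        ((i.factorial * m ^ m) * ((m + l - i).factorial * l ^ l)) := by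
        rw [e1]; gcongr
    _ = _ := by rw [← e2]; ring

/-- The binomial expansion has `m + l + 1` terms, none larger than the modal one; this loses only a
polynomial factor. -/
lemma add_pow_le_choose (m l : ℕ) :
    (m + l) ^ (m + l) ≤ (m + l + 1) * ((m + l).choose m * m ^ m * l ^ l) := by
  rw [add_pow]
  calc _ ≤ ∑ i ∈ Finset.range (m + l + 1), (m + l).choose m * m ^ m * l ^ l := by
        refine Finset.sum_le_sum fun i hi => ?_
        have := choose_mul_pow_le_mode m l i (by simpa [Nat.lt_succ_iff] using hi)
        calc _ = _ := ?_
          _ ≤ _ := this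
        push_cast; ring
    _ = _ := by simp

lemma choose_le_add_pow (m l : ℕ) :
    (m + l).choose m * m ^ m * l ^ l ≤ (m + l) ^ (m + l) := by
  rw [add_pow]
  have := Finset.single_le_sum (f := fun i => m ^ i * l ^ (m + l - i) * (m + l).choose i)
    (fun i _ => Nat.zero_le _) (Finset.mem_range.2 (by omega : m < m + l + 1))
  simp only [Nat.add_sub_cancel_left] at this
  calc _ = _ := ?_
    _ ≤ _ := this
  ring

lemma natCast_pow_self_pos (n : ℕ) : (0 : ℝ) < (n : ℝ) ^ n := by
  rcases Nat.eq_zero_or_pos n with rfl | h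
  · simp
  · positivity

lemma log_choose_le (m l : ℕ) :
    Real.log ((m + l).choose m) ≤ ((m + l : ℕ) : ℝ) * Real.log ((m + l : ℕ) : ℝ)
      - m * Real.log m - l * Real.log l := by
  have h : (((m + l).choose m : ℝ) * (m : ℝ) ^ m * (l : ℝ) ^ l) ≤ ((m + l : ℕ) : ℝ) ^ (m + l) := by
    exact_mod_cast choose_le_add_pow m l
  have hc : (0 : ℝ) < (m + l).choose m := by exact_mod_cast Nat.choose_pos (by omega)
  have hm := natCast_pow_self_pos m
  have hl := natCast_pow_self_pos l
  have := Real.log_le_log (by positivity) h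
  rw [Real.log_mul (by positivity) hl.ne', Real.log_mul hc.ne' hm.ne', Real.log_pow, Real.log_pow,
    Real.log_pow] at this
  linarith

lemma le_log_choose (m l : ℕ) :
    ((m + l : ℕ) : ℝ) * Real.log ((m + l : ℕ) : ℝ) - m * Real.log m - l * Real.log l
      - Real.log ((m + l : ℕ) + 1) ≤ Real.log ((m + l).choose m) := by
  have h : ((m + l : ℕ) : ℝ) ^ (m + l) ≤
      (((m + l : ℕ) : ℝ) + 1) * (((m + l).choose m : ℝ) * (m : ℝ) ^ m * (l : ℝ) ^ l) := by
    exact_mod_cast add_pow_le_choose m l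
  have hc : (0 : ℝ) < (m + l).choose m := by exact_mod_cast Nat.choose_pos (by omega)
  have hm := natCast_pow_self_pos m
  have hl := natCast_pow_self_pos l
  have := Real.log_le_log (natCast_pow_self_pos (m + l)) h
  rw [Real.log_mul (by positivity) (by positivity), Real.log_mul (by positivity) hl.ne',
    Real.log_mul hc.ne' hm.ne', Real.log_pow, Real.log_pow, Real.log_pow] at this
  linarith

/-- Rescaling by `N` splits off a part linear in `x`; these parts cancel in `log_choose_le` and
`le_log_choose`, because there `n = m + l`. -/
lemma mul_log_scale {N : ℝ} (hN : 0 < N) (x : ℝ) :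
    x * Real.log x = N * (-Real.negMulLog (x / N)) + x * Real.log N := by
  rcases eq_or_ne x 0 with rfl | hx
  · simp
  · rw [Real.negMulLog, Real.log_div hx hN.ne']
    field_simp
    ring

lemma tendsto_log_add_one_div : Tendsto (fun N : ℕ => Real.log ((N : ℝ) + 1) / N) atTop (𝓝 0) := by
  have h1 : Tendsto (fun N : ℕ => Real.log ((N : ℝ) + 1) / ((N : ℝ) + 1)) atTop (𝓝 0) := by
    have := (Real.isLittleO_log_id_atTop.tendsto_div_nhds_zero).comp
      (tendsto_atTop_add_const_right atTop (1 : ℝ) tendsto_natCast_atTop_atTop)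
    simpa [Function.comp_def] using this
  have h2 : Tendsto (fun N : ℕ => ((N : ℝ) + 1) / N) atTop (𝓝 1) := by
    have : Tendsto (fun N : ℕ => 1 + 1 / (N : ℝ)) atTop (𝓝 (1 + 0)) :=
      tendsto_const_nhds.add tendsto_one_div_atTop_nhds_zero_nat
    rw [add_zero] at this
    refine this.congr' ?_
    filter_upwards [eventually_gt_atTop 0] with N hN
    have : (N : ℝ) ≠ 0 := by positivity
    field_simp
  have := h1.mul h2
  rw [zero_mul] at this
  refine this.congr' ?_
  filter_upwards [eventually_gt_atTop 0] with N hN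
  have : (N : ℝ) ≠ 0 := by positivity
  field_simp

/-- First-order asymptotics of binomial coefficients. -/
lemma tendsto_log_choose_div {n m : ℕ → ℕ} {β α : ℝ} (hmn : ∀ᶠ N in atTop, m N ≤ n N)
    (hnN : ∀ᶠ N in atTop, n N ≤ N)
    (hn : Tendsto (fun N => (n N : ℝ) / N) atTop (𝓝 β))
    (hm : Tendsto (fun N => (m N : ℝ) / N) atTop (𝓝 α)) :
    Tendsto (fun N => Real.log ((n N).choose (m N)) / N) atTop
      (𝓝 (Real.negMulLog α + Real.negMulLog (β - α) - Real.negMulLog β)) := by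
  have hc := Real.continuous_negMulLog
  have hF : Tendsto (fun N : ℕ => Real.negMulLog ((m N : ℝ) / N)
      + Real.negMulLog ((n N : ℝ) / N - (m N : ℝ) / N) - Real.negMulLog ((n N : ℝ) / N)) atTop
      (𝓝 (Real.negMulLog α + Real.negMulLog (β - α) - Real.negMulLog β)) :=
    (((hc.tendsto _).comp hm).add ((hc.tendsto _).comp (hn.sub hm))).sub ((hc.tendsto _).comp hn)
  have hG := hF.sub tendsto_log_add_one_div
  rw [sub_zero] at hG
  have key : ∀ᶠ N : ℕ in atTop, ∃ l, n N = m N + l ∧ (0 : ℝ) < N ∧ n N ≤ N ∧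
      ((m N + l : ℕ) : ℝ) * Real.log ((m N + l : ℕ) : ℝ) - m N * Real.log (m N)
        - l * Real.log l = N * (Real.negMulLog ((m N : ℝ) / N)
      + Real.negMulLog ((n N : ℝ) / N - (m N : ℝ) / N) - Real.negMulLog ((n N : ℝ) / N)) := by
    filter_upwards [hmn, hnN, eventually_gt_atTop 0] with N h1 h2 h3
    obtain ⟨l, hl⟩ := Nat.exists_eq_add_of_le h1
    have hN : (0 : ℝ) < N := by exact_mod_cast h3
    refine ⟨l, hl, hN, h2, ?_⟩
    rw [mul_log_scale hN ((m N + l : ℕ) : ℝ), mul_log_scale hN (m N : ℝ),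
      mul_log_scale hN (l : ℝ), hl]
    have : ((m N + l : ℕ) : ℝ) / N - (m N : ℝ) / N = l / N := by push_cast; ring
    rw [this]
    push_cast
    ring
  refine tendsto_of_tendsto_of_tendsto_of_le_of_le' hG hF ?_ ?_
  · filter_upwards [key] with N ⟨l, hl, hN, hnN, e⟩
    have := le_log_choose (m N) l
    rw [e, ← hl] at this
    have h2 : Real.log ((n N : ℝ) + 1) ≤ Real.log ((N : ℝ) + 1) :=
      Real.log_le_log (by positivity) (by gcongr)
    rw [le_div_iff₀ hN, sub_mul, div_mul_cancel₀ _ hN.ne']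
    linarith
  · filter_upwards [key] with N ⟨l, hl, hN, _, e⟩
    have := log_choose_le (m N) l
    rw [e, ← hl] at this
    rw [div_le_iff₀ hN]
    linarith

/-! ### Tail bounds for the binomial distribution -/

/-- Chernoff bound for the lower tail of the binomial distribution. -/
lemma sum_binomial_le {p v : ℝ} (h1 : p < 1) (hv0 : 0 < v) (hvp : v ≤ p) (N : ℕ) :
    ∑ k ∈ (Finset.range (N + 1)).filter (fun k : ℕ => (k : ℝ) ≤ v * N),
      (N.choose k : ℝ) * (p ^ k * (1 - p) ^ (N - k)) ≤ (2 : ℝ) ^ (-((N : ℝ) * klBin v p)) := by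
  have h0 : 0 < p := hv0.trans_le hvp
  have hv1 : v < 1 := hvp.trans_lt h1
  have hlog2 : 0 < Real.log 2 := Real.log_pos one_lt_two
  have h1p : 0 < 1 - p := by linarith
  have h1v : 0 < 1 - v := by linarith
  set C := (2 : ℝ) ^ (-((N : ℝ) * klBin v p)) with hC
  -- Change of measure from `p` to `v`: the likelihood ratio is monotone in `k` because `v ≤ p`, and
  -- at `k = v N` it equals `C`. The tilted weights then sum to `1`.
  have hterm : ∀ k ≤ N, (k : ℝ) ≤ v * N →
      p ^ k * (1 - p) ^ (N - k) ≤ C * (v ^ k * (1 - v) ^ (N - k)) := by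
    intro k hkN hk
    rw [← Real.log_le_log_iff (by positivity) (by positivity), Real.log_mul (by positivity)
      (by positivity), Real.log_mul (by positivity) (by positivity), Real.log_mul (by positivity)
      (by positivity), Real.log_pow, Real.log_pow, Real.log_pow, Real.log_pow, hC,
      Real.log_rpow two_pos, klBin_eq_neg_binEntropy h0 h1,
      Real.binEntropy_eq_negMulLog_add_negMulLog_one_sub, Real.negMulLog, Real.negMulLog,
      Nat.cast_sub hkN, neg_mul, mul_assoc, div_mul_cancel₀ _ hlog2.ne']
    have a := Real.log_le_log hv0 hvp
    have b := Real.log_le_log h1p (by linarith : 1 - p ≤ 1 - v)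
    have c := mul_nonneg (sub_nonneg.2 hk)
      (by linarith : 0 ≤ (Real.log p - Real.log v) + (Real.log (1 - v) - Real.log (1 - p)))
    nlinarith [c]
  calc _ ≤ ∑ k ∈ (Finset.range (N + 1)).filter (fun k : ℕ => (k : ℝ) ≤ v * N),
      C * (v ^ k * (1 - v) ^ (N - k) * (N.choose k : ℝ)) := by
        refine Finset.sum_le_sum fun k hk => ?_
        rw [Finset.mem_filter, Finset.mem_range, Nat.lt_succ_iff] at hk
        have := mul_le_mul_of_nonneg_left (hterm k hk.1 hk.2) (Nat.cast_nonneg (N.choose k))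
        linarith
    _ ≤ ∑ k ∈ Finset.range (N + 1), C * (v ^ k * (1 - v) ^ (N - k) * (N.choose k : ℝ)) :=
        Finset.sum_le_sum_of_subset_of_nonneg (Finset.filter_subset _ _)
          fun k _ _ => by positivity
    _ = C := by
        rw [← Finset.mul_sum, ← add_pow]; simp

/-- The Chernoff bound for a fair coin, where every subset has weight `2 ^ (-N)` and the divergence
is `1 - H v`. -/
lemma sum_choose_le {v : ℝ} (hv0 : 0 < v) (hv1 : v ≤ 1 / 2) (N : ℕ) :
    ∑ k ∈ (Finset.range (N + 1)).filter (fun k : ℕ => (k : ℝ) ≤ v * N),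
      (N.choose k : ℝ) ≤ (2 : ℝ) ^ ((N : ℝ) * H v) := by
  have h := sum_binomial_le (p := 1 / 2) (by norm_num) hv0 hv1 N
  have hlog2 : 0 < Real.log 2 := Real.log_pos one_lt_two
  have e : klBin v (1 / 2) = 1 - H v := by
    rw [klBin_eq_neg_binEntropy (by norm_num) (by norm_num), H_eq_binEntropy_div,
      show (1 : ℝ) - 1 / 2 = 2⁻¹ by norm_num, show (1 : ℝ) / 2 = 2⁻¹ by norm_num, Real.log_inv]
    field_simp
    ring
  have e2 : ∑ k ∈ (Finset.range (N + 1)).filter (fun k : ℕ => (k : ℝ) ≤ v * N),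
      (N.choose k : ℝ) * ((1 / 2 : ℝ) ^ k * (1 - 1 / 2) ^ (N - k)) =
      (∑ k ∈ (Finset.range (N + 1)).filter (fun k : ℕ => (k : ℝ) ≤ v * N),
      (N.choose k : ℝ)) * ((2 : ℝ) ^ N)⁻¹ := by
    rw [Finset.sum_mul]
    refine Finset.sum_congr rfl fun k hk => ?_
    rw [Finset.mem_filter, Finset.mem_range, Nat.lt_succ_iff] at hk
    rw [show (1 : ℝ) - 1 / 2 = 1 / 2 by norm_num, ← pow_add, Nat.add_sub_cancel' hk.1]
    simp
  rw [e2, e, ← div_eq_mul_inv, div_le_iff₀ (by positivity), ← Real.rpow_natCast 2 N,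
    ← Real.rpow_add two_pos] at h
  have e3 : -((N : ℝ) * (1 - H v)) + N = N * H v := by ring
  rwa [e3] at h

/-- Chebyshev's inequality for the binomial distribution. -/
lemma sum_binomial_far_le {p : ℝ} (h0 : 0 ≤ p) (h1 : p ≤ 1) (N : ℕ) {a : ℝ} (ha : 0 < a) :
    ∑ k ∈ (Finset.range (N + 1)).filter (fun k : ℕ => a ≤ |N * p - k|),
      (N.choose k : ℝ) * (p ^ k * (1 - p) ^ (N - k)) ≤ N * (p * (1 - p)) / a ^ 2 := by
  have hv := congrArg (Polynomial.eval p) (bernsteinPolynomial.variance ℝ N)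
  simp only [Polynomial.eval_finsetSum, bernsteinPolynomial, nsmul_eq_mul] at hv
  simp only [Polynomial.eval_mul, Polynomial.eval_pow, Polynomial.eval_sub, Polynomial.eval_natCast,
    Polynomial.eval_X, Polynomial.eval_one] at hv
  have h1p : 0 ≤ 1 - p := by linarith
  rw [le_div_iff₀ (by positivity), ← mul_assoc, ← hv, Finset.sum_mul]
  calc _ ≤ ∑ k ∈ (Finset.range (N + 1)).filter (fun k : ℕ => a ≤ |N * p - k|),
      (N * p - k) ^ 2 * ((N.choose k : ℝ) * p ^ k * (1 - p) ^ (N - k)) := by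
        refine Finset.sum_le_sum fun k hk => ?_
        rw [Finset.mem_filter] at hk
        have : a ^ 2 ≤ (N * p - k) ^ 2 := by
          rw [← sq_abs (N * p - k)]; gcongr; exact hk.2
        have h2 : 0 ≤ (N.choose k : ℝ) * p ^ k * (1 - p) ^ (N - k) := by positivity
        have := mul_le_mul_of_nonneg_right this h2
        linarith
    _ ≤ _ := Finset.sum_le_sum_of_subset_of_nonneg (Finset.filter_subset _ _)
          fun k _ _ => by positivity

/-! ### Binary patterns as sets of positions -/

/-- The set of positions where a binary pattern has the letter `1`. -/
def ones {N : ℕ} (x : Fin N → Fin 2) : Finset (Fin N) := Finset.univ.filter (fun i => x i = 1)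

/-- The binary pattern with the letter `1` exactly on `s`. -/
def indicator {N : ℕ} (s : Finset (Fin N)) : Fin N → Fin 2 := fun i => if i ∈ s then 1 else 0

@[simp] lemma ones_indicator {N : ℕ} (s : Finset (Fin N)) : ones (indicator s) = s := by
  ext i; simp [ones, indicator]

@[simp] lemma indicator_ones {N : ℕ} (x : Fin N → Fin 2) : indicator (ones x) = x := by
  ext i
  simp only [ones, indicator, Finset.mem_filter, Finset.mem_univ, true_and]
  generalize x i = a
  revert a
  decide

/-- Binary patterns of length `N` correspond to subsets of `Fin N`. -/
def onesEquiv (N : ℕ) : Finset (Fin N) ≃ (Fin N → Fin 2) where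
  toFun := indicator
  invFun := ones
  left_inv := ones_indicator
  right_inv := indicator_ones

/-- This turns the distortion into a Hamming distance with a threshold that depends only on the
weight of `x`. It is checked letter by letter. -/
lemma dist_add_card_ones {N : ℕ} (x y : Fin N → Fin 2) :
    dist x y + (ones x).card = N + (symmDiff (ones x) (ones y)).card := by
  have h1 : (ones x).card = ∑ i, if x i = 1 then 1 else 0 := by simp [ones]
  have h2 : (symmDiff (ones x) (ones y)).card = ∑ i, if x i ≠ y i then 1 else 0 := by
    rw [← Finset.card_filter]
    congr 1
    ext i
    simp only [ones, Finset.mem_symmDiff, Finset.mem_filter, Finset.mem_univ, true_and]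
    generalize x i = a
    generalize y i = b
    revert a b
    decide
  have h3 : N = ∑ _i : Fin N, 1 := by simp
  have h4 : N + ∑ i, (if x i ≠ y i then 1 else 0) = ∑ i, (1 + if x i ≠ y i then 1 else 0) := by
    rw [Finset.sum_add_distrib, ← h3]
  rw [h1, h2, h4, dist, ← Finset.sum_add_distrib]
  refine Finset.sum_congr rfl fun i _ => ?_
  generalize x i = a
  generalize y i = b
  revert a b
  decide

lemma card_symmDiff_add {α : Type*} [DecidableEq α] (s t : Finset α) :
    (symmDiff s t).card + 2 * (s ∩ t).card = s.card + t.card := by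
  have h1 : (symmDiff s t).card = (s \ t).card + (t \ s).card := by
    rw [symmDiff_def, Finset.sup_eq_union]
    exact Finset.card_union_of_disjoint disjoint_sdiff_sdiff
  have h2 := Finset.card_sdiff_add_card_inter s t
  have h3 := Finset.card_sdiff_add_card_inter t s
  rw [Finset.inter_comm t s] at h3
  omega

/-! ### The error probability as a sum over uncovered sets -/

/-- Since the correct symbol is strictly more likely than any other, the hard decision is the
received symbol itself. The error pattern thus records where `r` agrees with `c`. -/
lemma isHardDecision_iff {A : Type*} [Fintype A] [DecidableEq A] {p : ℝ}
    (hpm : (1 - p) / ((Fintype.card A : ℝ) - 1) < p) (r a : A) :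
    IsHardDecision p r a ↔ r = a := by
  constructor
  · intro h
    by_contra hne
    have := h r hne
    simp only [symmChannel, if_true, if_neg hne] at this
    linarith
  · rintro rfl b hb
    simp only [symmChannel, if_true, if_neg hb.symm]
    exact hpm

lemma sum_symmChannel {A : Type*} [Fintype A] [DecidableEq A] [Nontrivial A] (p : ℝ) (c : A)
    (b : Fin 2) :
    ∑ r ∈ Finset.univ.filter (fun r => (if r = c then (1 : Fin 2) else 0) = b),
      symmChannel p c r = if b = 1 then p else 1 - p := by
  have hb : b = 0 ∨ b = 1 := by revert b; decide
  rcases hb with rfl | rfl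
  · have e : Finset.univ.filter (fun r => (if r = c then (1 : Fin 2) else 0) = 0)
        = Finset.univ.erase c := by
      ext r; by_cases h : r = c <;> simp [h]
    rw [e, if_neg (by decide)]
    have hcard : (1 : ℝ) < Fintype.card A := by exact_mod_cast Fintype.one_lt_card
    calc _ = ∑ r ∈ Finset.univ.erase c, (1 - p) / ((Fintype.card A : ℝ) - 1) := by
          refine Finset.sum_congr rfl fun r hr => ?_
          rw [symmChannel, if_neg (Finset.ne_of_mem_erase hr)]
      _ = _ := by
          rw [Finset.sum_const, Finset.card_erase_of_mem (Finset.mem_univ c), Finset.card_univ,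
            nsmul_eq_mul, Nat.cast_sub Fintype.card_pos, Nat.cast_one]
          have : (Fintype.card A : ℝ) - 1 ≠ 0 := by linarith
          field_simp
  · have e : Finset.univ.filter (fun r => (if r = c then (1 : Fin 2) else 0) = 1) = {c} := by
      ext r; by_cases h : r = c <;> simp [h]
    rw [e, if_pos rfl, Finset.sum_singleton, symmChannel, if_pos rfl]

/-- The error pattern is distributed as a sequence of independent Bernoulli variables. -/
lemma sum_errorPattern {A : Type*} [Fintype A] [DecidableEq A] [Nontrivial A] {p : ℝ}
    (hpm : (1 - p) / ((Fintype.card A : ℝ) - 1) < p) {N : ℕ} (c : Fin N → A)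
    (x : Fin N → Fin 2) :
    ∑ r ∈ Finset.univ.filter (fun r => errorPattern p c r = x), ∏ i, symmChannel p (c i) (r i)
      = p ^ (ones x).card * (1 - p) ^ (N - (ones x).card) := by
  have e : Finset.univ.filter (fun r => errorPattern p c r = x) =
      Fintype.piFinset fun i =>
        Finset.univ.filter (fun r => (if r = c i then (1 : Fin 2) else 0) = x i) := by
    ext r
    simp only [errorPattern, isHardDecision_iff hpm, Finset.mem_filter, Finset.mem_univ, true_and,
      Fintype.mem_piFinset, funext_iff]
  rw [e, ← Finset.prod_univ_sum]
  simp only [sum_symmChannel]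
  rw [Finset.prod_ite, Finset.prod_const, Finset.prod_const]
  congr 2
  have := Finset.card_filter_add_card_filter_not (s := (Finset.univ : Finset (Fin N)))
    (fun i => x i = 1)
  rw [Finset.card_univ, Fintype.card_fin] at this
  simp only [ones]
  omega

open Classical in
/-- The subsets (of ones) that no pattern of `B` covers. -/
def uncovered {N : ℕ} (B : Finset (Fin N → Fin 2)) (D : ℝ) : Finset (Finset (Fin N)) :=
  Finset.univ.filter fun s => ∀ y ∈ B, D < (dist (indicator s) y : ℝ)

/-- The right side involves neither `c` nor the alphabet, so one choice of `B` serves all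
transmitted words. -/
lemma errorProb_eq {A : Type*} [Fintype A] [DecidableEq A] [Nontrivial A] {p : ℝ}
    (hpm : (1 - p) / ((Fintype.card A : ℝ) - 1) < p) {N : ℕ} (c : Fin N → A)
    (B : Finset (Fin N → Fin 2)) (D : ℝ) :
    errorProb p c B D = ∑ s ∈ uncovered B D, p ^ s.card * (1 - p) ^ (N - s.card) := by
  classical
  rw [errorProb, ← Finset.sum_fiberwise (g := errorPattern p c), uncovered, Finset.sum_filter,
    ← (onesEquiv N).sum_comp]
  refine Finset.sum_congr rfl fun s _ => ?_
  have h := sum_errorPattern hpm c (indicator s)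
  rw [ones_indicator] at h
  rw [← h]
  by_cases hs : ∀ y ∈ B, D < (dist (indicator s) y : ℝ)
  · rw [if_pos hs]
    refine Finset.sum_congr rfl fun r hr => ?_
    rw [(Finset.mem_filter.1 hr).2]
    exact if_pos hs
  · rw [if_neg hs]
    refine Finset.sum_eq_zero fun r hr => ?_
    rw [(Finset.mem_filter.1 hr).2]
    exact if_neg hs

lemma sum_card_eq {N : ℕ} (f : ℕ → ℝ) :
    ∑ s : Finset (Fin N), f s.card = ∑ k ∈ Finset.range (N + 1), (N.choose k : ℝ) * f k := by
  have := Finset.sum_powerset_apply_card f (x := (Finset.univ : Finset (Fin N)))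
  simpa [nsmul_eq_mul] using this

lemma uncovered_empty {N : ℕ} (D : ℝ) : uncovered (∅ : Finset (Fin N → Fin 2)) D = Finset.univ := by
  simp [uncovered]

lemma errorProb_empty {A : Type*} [Fintype A] [DecidableEq A] [Nontrivial A] {p : ℝ}
    (hpm : (1 - p) / ((Fintype.card A : ℝ) - 1) < p) {N : ℕ} (c : Fin N → A) (D : ℝ) :
    errorProb p c ∅ D = 1 := by
  rw [errorProb_eq hpm, uncovered_empty, sum_card_eq fun k => p ^ k * (1 - p) ^ (N - k)]
  calc _ = (p + (1 - p)) ^ N := by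
        rw [add_pow]; exact Finset.sum_congr rfl fun k _ => by ring
    _ = 1 := by simp

lemma errorProb_nonneg {A : Type*} [Fintype A] [DecidableEq A] [Nontrivial A] {p : ℝ}
    (h0 : 0 < p) (h1 : p < 1)
    (hpm : (1 - p) / ((Fintype.card A : ℝ) - 1) < p) {N : ℕ} (c : Fin N → A)
    (B : Finset (Fin N → Fin 2)) (D : ℝ) : 0 ≤ errorProb p c B D := by
  have : 0 < 1 - p := by linarith
  rw [errorProb_eq hpm]
  exact Finset.sum_nonneg fun s _ => by positivity

lemma errorProb_le_of_cover {A : Type*} [Fintype A] [DecidableEq A] [Nontrivial A] {p : ℝ}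
    (h0 : 0 < p) (h1 : p < 1)
    (hpm : (1 - p) / ((Fintype.card A : ℝ) - 1) < p) {N : ℕ} (c : Fin N → A)
    (B : Finset (Fin N → Fin 2)) (D : ℝ) (K : ℕ → Prop) [DecidablePred K]
    (hB : ∀ s ∈ uncovered B D, K s.card) :
    errorProb p c B D ≤ ∑ k ∈ (Finset.range (N + 1)).filter K,
      (N.choose k : ℝ) * (p ^ k * (1 - p) ^ (N - k)) := by
  have hp : 0 < 1 - p := by linarith
  rw [errorProb_eq hpm]
  calc _ ≤ ∑ s ∈ uncovered B D, if K s.card then p ^ s.card * (1 - p) ^ (N - s.card) else 0 := by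
        exact Finset.sum_le_sum fun s hs => by rw [if_pos (hB s hs)]
    _ ≤ ∑ s : Finset (Fin N), if K s.card then p ^ s.card * (1 - p) ^ (N - s.card) else 0 :=
        Finset.sum_le_sum_of_subset_of_nonneg (Finset.subset_univ _) fun s _ _ => by positivity
    _ = _ := by
        rw [sum_card_eq fun k => if K k then p ^ k * (1 - p) ^ (N - k) else 0, Finset.sum_filter]
        simp

/-- All patterns of equal weight are equally likely, so half of a shell carries half of its
probability. -/
lemma le_errorProb_of_uncovered {A : Type*} [Fintype A] [DecidableEq A] [Nontrivial A] {p : ℝ}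
    (h0 : 0 < p) (h1 : p < 1)
    (hpm : (1 - p) / ((Fintype.card A : ℝ) - 1) < p) {N : ℕ} (c : Fin N → A)
    (B : Finset (Fin N → Fin 2)) (D : ℝ) (K : Finset ℕ)
    (hB : ∀ k ∈ K, (N.choose k : ℝ) / 2 ≤
      ((uncovered B D).filter fun s => s.card = k).card) :
    (∑ k ∈ K, (N.choose k : ℝ) * (p ^ k * (1 - p) ^ (N - k))) / 2 ≤ errorProb p c B D := by
  have hp : 0 < 1 - p := by linarith
  rw [errorProb_eq hpm]
  calc _ ≤ ∑ k ∈ K, ∑ s ∈ (uncovered B D).filter (fun s => s.card = k),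
        p ^ s.card * (1 - p) ^ (N - s.card) := by
        rw [Finset.sum_div]
        refine Finset.sum_le_sum fun k hk => ?_
        calc _ = (N.choose k : ℝ) / 2 * (p ^ k * (1 - p) ^ (N - k)) := by ring
          _ ≤ ((uncovered B D).filter fun s => s.card = k).card *
              (p ^ k * (1 - p) ^ (N - k)) := by
              gcongr; exact hB k hk
          _ = _ := by
              rw [← nsmul_eq_mul, ← Finset.sum_const]
              refine Finset.sum_congr rfl fun s hs => ?_
              rw [(Finset.mem_filter.1 hs).2]
    _ = ∑ s ∈ (uncovered B D).filter (fun s => s.card ∈ K),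
        p ^ s.card * (1 - p) ^ (N - s.card) := by
        rw [← Finset.sum_fiberwise_of_maps_to (s := (uncovered B D).filter fun s => s.card ∈ K)
          (t := K) (g := Finset.card) fun s hs => (Finset.mem_filter.1 hs).2]
        refine Finset.sum_congr rfl fun k hk => ?_
        congr 1
        ext s
        simp only [Finset.mem_filter]
        constructor
        · rintro ⟨h, rfl⟩; exact ⟨⟨h, hk⟩, rfl⟩
        · rintro ⟨⟨h, -⟩, h2⟩; exact ⟨h, h2⟩
    _ ≤ _ := Finset.sum_le_sum_of_subset_of_nonneg (Finset.filter_subset _ _)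
        fun s _ _ => by positivity

/-! ### Volume bound for the converse -/

/-- Symmetric difference with `y` is an involution that moves the centre to `∅`, where the ball is a
sum of binomial coefficients. -/
lemma card_hammingBall_le {v : ℝ} (hv0 : 0 < v) (hv1 : v ≤ 1 / 2) {N : ℕ} (y : Finset (Fin N)) :
    ((Finset.univ.filter fun s : Finset (Fin N) => ((symmDiff s y).card : ℝ) ≤ v * N).card : ℝ)
      ≤ (2 : ℝ) ^ ((N : ℝ) * H v) := by
  refine le_trans (le_of_eq ?_) (sum_choose_le hv0 hv1 N)
  rw [Finset.card_filter, Nat.cast_sum]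
  have e : Function.Involutive fun s : Finset (Fin N) => symmDiff s y :=
    fun s => symmDiff_symmDiff_cancel_right y s
  refine (Equiv.sum_comp e.toPerm fun s : Finset (Fin N) =>
    ((if (s.card : ℝ) ≤ v * N then 1 else 0 : ℕ) : ℝ)).trans ?_
  rw [sum_card_eq fun k => ((if (k : ℝ) ≤ v * N then 1 else 0 : ℕ) : ℝ), Finset.sum_filter]
  refine Finset.sum_congr rfl fun k _ => ?_
  split_ifs <;> simp

/-- In a weight shell whose elements have to be approximated within Hamming distance `v N`, the
patterns of `B` cover at most `|B| 2 ^ (N H(v))` elements. -/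
lemma choose_sub_le_card_uncovered {v : ℝ} (hv0 : 0 < v) (hv1 : v ≤ 1 / 2) {N : ℕ}
    (B : Finset (Fin N → Fin 2)) {D : ℝ} {k : ℕ} (hk : D + k - N ≤ v * N) :
    (N.choose k : ℝ) - B.card * (2 : ℝ) ^ ((N : ℝ) * H v) ≤
      ((uncovered B D).filter fun s => s.card = k).card := by
  classical
  set ball := fun y : Fin N → Fin 2 =>
    Finset.univ.filter fun s : Finset (Fin N) => ((symmDiff s (ones y)).card : ℝ) ≤ v * N
  have hsub : Finset.powersetCard k (Finset.univ : Finset (Fin N)) ⊆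
      ((uncovered B D).filter fun s => s.card = k) ∪ B.biUnion ball := by
    intro s hs
    rw [Finset.mem_powersetCard] at hs
    rw [Finset.mem_union, Finset.mem_filter, uncovered, Finset.mem_filter]
    by_cases h : ∀ y ∈ B, D < (dist (indicator s) y : ℝ)
    · exact Or.inl ⟨⟨Finset.mem_univ _, h⟩, hs.2⟩
    · right
      push Not at h
      obtain ⟨y, hy, hd⟩ := h
      have := dist_add_card_ones (indicator s) y
      rw [ones_indicator, hs.2] at this
      have : (dist (indicator s) y : ℝ) + k = N + (symmDiff s (ones y)).card := by
        exact_mod_cast this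
      simp only [Finset.mem_biUnion, ball, Finset.mem_filter, Finset.mem_univ, true_and]
      exact ⟨y, hy, by linarith⟩
  have h1 := (Finset.card_le_card hsub).trans (Finset.card_union_le _ _)
  rw [Finset.card_powersetCard, Finset.card_univ, Fintype.card_fin] at h1
  have h2 : ((B.biUnion ball).card : ℝ) ≤ B.card * (2 : ℝ) ^ ((N : ℝ) * H v) := by
    calc ((B.biUnion ball).card : ℝ) ≤ ∑ y ∈ B, ((ball y).card : ℝ) := by
          exact_mod_cast Finset.card_biUnion_le
      _ ≤ ∑ y ∈ B, (2 : ℝ) ^ ((N : ℝ) * H v) :=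
          Finset.sum_le_sum fun y _ => card_hammingBall_le hv0 hv1 (ones y)
      _ = _ := by rw [Finset.sum_const, nsmul_eq_mul]
  have h3 : (N.choose k : ℝ) ≤ ((uncovered B D).filter fun s => s.card = k).card
      + (B.biUnion ball).card := by exact_mod_cast h1
  linarith

/-! ### Greedy coverings -/

/-- One step of the greedy covering argument: some candidate covers an average share of `U`. -/
lemma exists_covers_average {α β : Type*} [DecidableEq α] (r : α → β → Prop) [∀ x y, Decidable (r x y)]
    (U : Finset α) (Y : Finset β) (hY : Y.Nonempty) (m : ℕ)
    (hm : ∀ x ∈ U, m ≤ (Y.filter (r x)).card) :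
    ∃ y ∈ Y, (U.filter fun x => ¬ r x y).card * Y.card ≤ U.card * (Y.card - m : ℤ) := by
  -- Double counting of the related pairs; if every candidate did worse than average, the total
  -- would be too small.
  have h : ∑ y ∈ Y, ((U.filter fun x => r x y).card : ℤ) ≥ U.card * m := by
    have e : ∑ y ∈ Y, (U.filter fun x => r x y).card = ∑ x ∈ U, (Y.filter (r x)).card := by
      simp only [Finset.card_filter]
      exact Finset.sum_comm
    have h2 : U.card * m ≤ ∑ x ∈ U, (Y.filter (r x)).card := by
      simpa using Finset.card_nsmul_le_sum U _ m hm
    rw [← e] at h2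
    exact_mod_cast h2
  by_contra! hcon
  have h3 : ∑ y ∈ Y, (U.card * (Y.card - m : ℤ)) <
      ∑ y ∈ Y, ((U.filter fun x => ¬ r x y).card : ℤ) * Y.card :=
    Finset.sum_lt_sum_of_nonempty hY fun y hy => hcon y hy
  have h4 : ∀ y, ((U.filter fun x => ¬ r x y).card : ℤ) = U.card - (U.filter fun x => r x y).card := by
    intro y
    have := Finset.card_filter_add_card_filter_not (s := U) (fun x => r x y)
    omega
  simp only [h4] at h3
  rw [Finset.sum_const, nsmul_eq_mul, ← Finset.sum_mul, Finset.sum_sub_distrib, Finset.sum_const,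
    nsmul_eq_mul] at h3
  have hYpos : (0 : ℤ) < Y.card := by exact_mod_cast hY.card_pos
  nlinarith

lemma exists_greedy_cover {α β : Type*} [DecidableEq α] [DecidableEq β] (r : α → β → Prop)
    [∀ x y, Decidable (r x y)]
    (X : Finset α) (Y : Finset β) (hY : Y.Nonempty) (m : ℕ)
    (hm : ∀ x ∈ X, m ≤ (Y.filter (r x)).card) (n : ℕ) :
    ∃ B ⊆ Y, B.card ≤ n ∧
      ((X.filter fun x => ∀ y ∈ B, ¬ r x y).card : ℝ) ≤ X.card * Real.exp (-(n * (m / Y.card : ℝ))) := by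
  induction n with
  | zero => exact ⟨∅, by simp, by simp, by simp⟩
  | succ n ih =>
    obtain ⟨B, hBY, hBn, hB⟩ := ih
    obtain ⟨y, hy, h⟩ := exists_covers_average r (X.filter fun x => ∀ y ∈ B, ¬ r x y) Y hY m
      fun x hx => hm x (Finset.mem_filter.1 hx).1
    refine ⟨insert y B, Finset.insert_subset hy hBY, (Finset.card_insert_le _ _).trans (by omega), ?_⟩
    have hYpos : (0 : ℝ) < Y.card := by exact_mod_cast hY.card_pos
    have e : (X.filter fun x => ∀ z ∈ insert y B, ¬ r x z) =
        (X.filter fun x => ∀ y ∈ B, ¬ r x y).filter fun x => ¬ r x y := by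
      ext x
      simp only [Finset.mem_filter, Finset.mem_insert, forall_eq_or_imp]
      tauto
    rw [← e] at h
    have h' : ((X.filter fun x => ∀ z ∈ insert y B, ¬ r x z).card : ℝ) * Y.card ≤
        (X.filter fun x => ∀ y ∈ B, ¬ r x y).card * ((Y.card : ℝ) - m) := by exact_mod_cast h
    have h2 : ((X.filter fun x => ∀ z ∈ insert y B, ¬ r x z).card : ℝ) ≤
        (X.filter fun x => ∀ y ∈ B, ¬ r x y).card * (1 - m / Y.card) := by
      rw [show (1 : ℝ) - m / Y.card = (Y.card - m) / Y.card by field_simp, ← mul_div_assoc,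
        le_div_iff₀ hYpos]
      exact h'
    have h3 : 1 - (m / Y.card : ℝ) ≤ Real.exp (-(m / Y.card : ℝ)) := by
      have := Real.add_one_le_exp (-(m / Y.card : ℝ)); linarith
    calc _ ≤ _ := h2
      _ ≤ ((X.filter fun x => ∀ y ∈ B, ¬ r x y).card : ℝ) * Real.exp (-(m / Y.card : ℝ)) := by gcongr
      _ ≤ X.card * Real.exp (-(n * (m / Y.card : ℝ))) * Real.exp (-(m / Y.card : ℝ)) := by gcongr
      _ = _ := by rw [mul_assoc, ← Real.exp_add]; push_cast; ring_nf

/-- Number of `j`-subsets that meet a given set in at least `a` elements. -/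
lemma choose_mul_choose_le_card {N a j : ℕ} (haj : a ≤ j) (s : Finset (Fin N)) :
    s.card.choose a * (N - s.card).choose (j - a) ≤
      ((Finset.powersetCard j (Finset.univ : Finset (Fin N))).filter
        fun y => a ≤ (s ∩ y).card).card := by
  have hc : sᶜ.card = N - s.card := by rw [Finset.card_compl, Fintype.card_fin]
  rw [← hc, ← Finset.card_powersetCard, ← Finset.card_powersetCard, ← Finset.card_product]
  -- A set `P ∪ Q` with `P` inside `s` and `Q` outside determines both parts, which makes the map
  -- `(P, Q) ↦ P ∪ Q` injective.
  have hinter : ∀ P ⊆ s, ∀ Q ⊆ sᶜ, s ∩ (P ∪ Q) = P ∧ sᶜ ∩ (P ∪ Q) = Q := by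
    intro P hP Q hQ
    constructor
    · ext i
      have h1 := @hP i
      have h2 := @hQ i
      simp only [Finset.mem_inter, Finset.mem_union, Finset.mem_compl] at *
      tauto
    · ext i
      have h1 := @hP i
      have h2 := @hQ i
      simp only [Finset.mem_inter, Finset.mem_union, Finset.mem_compl] at *
      tauto
  refine Finset.card_le_card_of_injOn (fun z => z.1 ∪ z.2) ?_ ?_
  · rintro ⟨P, Q⟩ h
    simp only [Finset.coe_product, Set.mem_prod, Finset.mem_coe, Finset.mem_powersetCard] at h
    obtain ⟨⟨hP, hPa⟩, hQ, hQa⟩ := h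
    have hd : Disjoint P Q :=
      Finset.disjoint_of_subset_left hP (Finset.disjoint_of_subset_right hQ disjoint_compl_right)
    simp only [Finset.coe_filter, Finset.mem_powersetCard, Set.mem_ofPred_eq]
    refine ⟨⟨Finset.subset_univ _, ?_⟩, ?_⟩
    · rw [Finset.card_union_of_disjoint hd]; omega
    · rw [(hinter P hP Q hQ).1]; omega
  · rintro ⟨P, Q⟩ h ⟨P', Q'⟩ h' e
    simp only [Finset.coe_product, Set.mem_prod, Finset.mem_coe, Finset.mem_powersetCard] at h h' e
    have a1 := hinter P h.1.1 Q h.2.1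
    have a2 := hinter P' h'.1.1 Q' h'.2.1
    rw [e] at a1
    exact Prod.ext (a1.1.symm.trans a2.1) (a1.2.symm.trans a2.2)

/-- A family of `j`-subsets of the size given by random coding such that every set with at least
`k` elements meets a member of the family in at least `a` elements. -/
lemma exists_overlap_cover {N k j a : ℕ} (hN : 0 < N) (hjN : j ≤ N) (hak : a ≤ k)
    (haj : a ≤ j) (hjk : j - a ≤ N - k) :
    ∃ B : Finset (Finset (Fin N)),
      (B.card : ℝ) ≤ N * ((N.choose j : ℝ) / (k.choose a * (N - k).choose (j - a))) + 1 ∧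
      ∀ s : Finset (Fin N), k ≤ s.card → ∃ y ∈ B, y.card = j ∧ a ≤ (s ∩ y).card := by
  set Y := Finset.powersetCard j (Finset.univ : Finset (Fin N)) with hYdef
  set X := Finset.powersetCard k (Finset.univ : Finset (Fin N)) with hXdef
  have hYc : Y.card = N.choose j := by simp [hYdef]
  have hXc : X.card = N.choose k := by simp [hXdef]
  have hYpos : 0 < Y.card := by rw [hYc]; exact Nat.choose_pos hjN
  set m := k.choose a * (N - k).choose (j - a) with hm
  have hmpos : 0 < m := Nat.mul_pos (Nat.choose_pos hak) (Nat.choose_pos hjk)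
  set q := (m : ℝ) / Y.card with hq
  have hmR : (0 : ℝ) < m := by exact_mod_cast hmpos
  have hYR : (0 : ℝ) < Y.card := by exact_mod_cast hYpos
  have hqpos : 0 < q := by positivity
  obtain ⟨B, hBY, hBn, hB⟩ := exists_greedy_cover (fun s y : Finset (Fin N) => a ≤ (s ∩ y).card)
    X Y (Finset.card_pos.1 hYpos) m (fun s hs => by
      have h := choose_mul_choose_le_card haj s
      rw [(Finset.mem_powersetCard.1 hs).2] at h
      -- Each round leaves at most a fraction `exp (-q)`, so `N / q` rounds leave at most `2 ^ N *
      -- exp (-N) < 1` of the shell, hence nothing.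
      exact h) ⌈(N : ℝ) / q⌉₊
  refine ⟨B, ?_, ?_⟩
  · have h1 : (B.card : ℝ) ≤ (⌈(N : ℝ) / q⌉₊ : ℝ) := by exact_mod_cast hBn
    have h2 := Nat.ceil_lt_add_one (show 0 ≤ (N : ℝ) / q by positivity)
    have h3 : (N : ℝ) / q = N * ((N.choose j : ℝ) / (k.choose a * (N - k).choose (j - a))) := by
      rw [hq, hYc, hm]; push_cast; rw [div_div_eq_mul_div, mul_div_assoc]
    linarith
  · have hlt : ((X.filter fun s => ∀ y ∈ B, ¬ a ≤ (s ∩ y).card).card : ℝ) < 1 := by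
      refine lt_of_le_of_lt (le_trans (le_of_eq (by congr)) hB) ?_
      have h1 : (X.card : ℝ) ≤ 2 ^ N := by rw [hXc]; exact_mod_cast Nat.choose_le_two_pow N k
      have h2 : (N : ℝ) ≤ ⌈(N : ℝ) / q⌉₊ * q := by
        rw [← div_le_iff₀ hqpos]; exact Nat.le_ceil _
      calc (X.card : ℝ) * Real.exp (-(⌈(N : ℝ) / q⌉₊ * q)) ≤ 2 ^ N * Real.exp (-N) := by
            gcongr
        _ = (2 * Real.exp (-1)) ^ N := by
            rw [mul_pow, ← Real.exp_nat_mul]; simp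
        _ < 1 := by
            refine pow_lt_one₀ (by positivity) ?_ hN.ne'
            rw [Real.exp_neg, ← div_eq_mul_inv, div_lt_one (Real.exp_pos 1)]
            exact lt_trans (by norm_num) Real.exp_one_gt_d9
    have hempty : (X.filter fun s => ∀ y ∈ B, ¬ a ≤ (s ∩ y).card) = ∅ := by
      rw [← Finset.card_eq_zero]
      exact Nat.lt_one_iff.1 (by exact_mod_cast hlt)
    intro s hs
    -- Only sets of size exactly `k` were covered; a larger `s` inherits the overlap from a
    -- `k`-subset.
    obtain ⟨s', hs', hcard⟩ := Finset.exists_subset_card_eq hs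
    have hs'X : s' ∈ X := Finset.mem_powersetCard.2 ⟨Finset.subset_univ _, hcard⟩
    have := Finset.eq_empty_iff_forall_notMem.1 hempty s'
    rw [Finset.mem_filter] at this
    push Not at this
    obtain ⟨y, hy, hay⟩ := this hs'X
    exact ⟨y, hy, (Finset.mem_powersetCard.1 (hBY hy)).2,
      hay.trans (Finset.card_le_card (Finset.inter_subset_inter_right hs'))⟩

/-- Erasure patterns that bring every error pattern with at least `k` correct positions within
distortion `N + j - 2 a`. -/
lemma exists_pattern_cover {N k j a : ℕ} {D : ℝ} (hN : 0 < N) (hjN : j ≤ N)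
    (hak : a ≤ k) (haj : a ≤ j) (hjk : j - a ≤ N - k) (hD : (N : ℝ) + j - 2 * a ≤ D) :
    ∃ B : Finset (Fin N → Fin 2),
      (B.card : ℝ) ≤ N * ((N.choose j : ℝ) / (k.choose a * (N - k).choose (j - a))) + 1 ∧
      ∀ s ∈ uncovered B D, s.card < k := by
  obtain ⟨B, hB, hcov⟩ := exists_overlap_cover hN hjN hak haj hjk
  refine ⟨B.map (onesEquiv N).toEmbedding, by simpa using hB, ?_⟩
  intro s hs
  by_contra! hks
  obtain ⟨y, hy, hyj, hya⟩ := hcov s hks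
  have h := (Finset.mem_filter.1 hs).2 (indicator y)
    (Finset.mem_map_of_mem (onesEquiv N).toEmbedding hy)
  have h1 := dist_add_card_ones (indicator s) (indicator y)
  have h2 := card_symmDiff_add s y
  rw [ones_indicator, ones_indicator] at h1
  have h3 : dist (indicator s) (indicator y) + 2 * (s ∩ y).card = N + j := by omega
  have h4 : (dist (indicator s) (indicator y) : ℝ) + 2 * (s ∩ y).card = N + j := by
    exact_mod_cast h3
  have h5 : (a : ℝ) ≤ (s ∩ y).card := by exact_mod_cast hya
  linarith

/-! ### Limits of rounded sequences divided by the block length -/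

lemma tendsto_ceil_div {f : ℕ → ℝ} {x : ℝ} (hx : 0 ≤ x)
    (hf : Tendsto (fun N : ℕ => f N / N) atTop (𝓝 x)) :
    Tendsto (fun N : ℕ => (⌈f N⌉₊ : ℝ) / N) atTop (𝓝 x) := by
  have h1 : Tendsto (fun N : ℕ => max (f N / N) 0 + 1 / (N : ℝ)) atTop (𝓝 (max x 0 + 0)) :=
    (hf.max tendsto_const_nhds).add tendsto_one_div_atTop_nhds_zero_nat
  rw [max_eq_left hx, add_zero] at h1
  refine tendsto_of_tendsto_of_tendsto_of_le_of_le' hf h1 ?_ ?_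
  · filter_upwards [eventually_gt_atTop 0] with N hN
    gcongr
    exact Nat.le_ceil _
  · filter_upwards [eventually_gt_atTop 0] with N hN
    have hN' : (0 : ℝ) < N := by exact_mod_cast hN
    rcases le_total (f N) 0 with h | h
    · rw [Nat.ceil_eq_zero.2 h]
      simp only [Nat.cast_zero, zero_div]
      positivity
    · calc (⌈f N⌉₊ : ℝ) / N ≤ (f N + 1) / N := by
            gcongr; exact (Nat.ceil_lt_add_one h).le
        _ = f N / N + 1 / N := by ring
        _ ≤ _ := by gcongr; exact le_max_left _ _

lemma tendsto_cast_max_div {f g : ℕ → ℕ} {x y : ℝ}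
    (hf : Tendsto (fun N : ℕ => (f N : ℝ) / N) atTop (𝓝 x))
    (hg : Tendsto (fun N : ℕ => (g N : ℝ) / N) atTop (𝓝 y)) :
    Tendsto (fun N : ℕ => ((max (f N) (g N) : ℕ) : ℝ) / N) atTop (𝓝 (max x y)) := by
  refine (hf.max hg).congr fun N => ?_
  rw [Nat.cast_max, max_div_div_right (Nat.cast_nonneg N)]

lemma tendsto_cast_min_div {f g : ℕ → ℕ} {x y : ℝ}
    (hf : Tendsto (fun N : ℕ => (f N : ℝ) / N) atTop (𝓝 x))
    (hg : Tendsto (fun N : ℕ => (g N : ℝ) / N) atTop (𝓝 y)) :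
    Tendsto (fun N : ℕ => ((min (f N) (g N) : ℕ) : ℝ) / N) atTop (𝓝 (min x y)) := by
  refine (hf.min hg).congr fun N => ?_
  rw [Nat.cast_min, min_div_div_right (Nat.cast_nonneg N)]

lemma tendsto_cast_sub_div {f g : ℕ → ℕ} {x y : ℝ} (hle : ∀ᶠ N in atTop, g N ≤ f N)
    (hf : Tendsto (fun N : ℕ => (f N : ℝ) / N) atTop (𝓝 x))
    (hg : Tendsto (fun N : ℕ => (g N : ℝ) / N) atTop (𝓝 y)) :
    Tendsto (fun N : ℕ => ((f N - g N : ℕ) : ℝ) / N) atTop (𝓝 (x - y)) := by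
  refine (hf.sub hg).congr' ?_
  filter_upwards [hle] with N h
  rw [Nat.cast_sub h, sub_div]

lemma tendsto_self_div : Tendsto (fun N : ℕ => (N : ℝ) / N) atTop (𝓝 1) := by
  refine tendsto_const_nhds.congr' ?_
  filter_upwards [eventually_gt_atTop 0] with N hN
  have : (N : ℝ) ≠ 0 := by positivity
  rw [div_self this]

lemma eventually_lt_of_tendsto_div {f g : ℕ → ℝ} {x y : ℝ} (hxy : x < y)
    (hf : Tendsto (fun N : ℕ => f N / N) atTop (𝓝 x))
    (hg : Tendsto (fun N : ℕ => g N / N) atTop (𝓝 y)) : ∀ᶠ N in atTop, f N < g N := by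
  filter_upwards [hf.eventually_lt hg hxy, eventually_gt_atTop 0] with N h hN
  have hN' : (0 : ℝ) < N := by exact_mod_cast hN
  exact (div_lt_div_iff_of_pos_right hN').1 h

lemma eventually_two_mul_add_one_le {ε : ℝ} (hε : 0 < ε) :
    ∀ᶠ N : ℕ in atTop, 2 * ((N : ℝ) + 1) ≤ (2 : ℝ) ^ ((N : ℝ) * ε) := by
  have hlog2 : 0 < Real.log 2 := Real.log_pos one_lt_two
  have h : Tendsto (fun N : ℕ => Real.log 2 * (1 / (N : ℝ)) + Real.log ((N : ℝ) + 1) / N) atTop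
      (𝓝 (Real.log 2 * 0 + 0)) :=
    (tendsto_one_div_atTop_nhds_zero_nat.const_mul _).add tendsto_log_add_one_div
  rw [mul_zero, add_zero] at h
  filter_upwards [h.eventually_lt_const (mul_pos hlog2 hε), eventually_gt_atTop 0] with N h1 hN
  have hN' : (0 : ℝ) < N := by exact_mod_cast hN
  rw [← Real.log_le_log_iff (by positivity) (by positivity), Real.log_mul (by norm_num)
    (by positivity), Real.log_rpow two_pos]
  rw [mul_one_div, ← add_div, div_lt_iff₀ hN'] at h1
  linarith

/-! ### Choice of the code and achievability -/

/-- Optimal overlap parameters for the Hamming covering problem of the shell of relative weight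
`u`, with relative radius `u - t`. -/
lemma exists_overlap_parameters {t u : ℝ} (ht0 : 0 ≤ t) (htu : t ≤ u) (hu1 : u < 1) {k T : ℕ → ℕ}
    (hk : Tendsto (fun N => (k N : ℝ) / N) atTop (𝓝 u))
    (hT : Tendsto (fun N => (T N : ℝ) / N) atTop (𝓝 t)) (hTk : ∀ N, T N ≤ k N) :
    ∃ j a : ℕ → ℕ,
      (∀ᶠ N in atTop, j N ≤ N ∧ a N ≤ k N ∧ a N ≤ j N ∧ j N - a N ≤ N - k N ∧
        j N + T N ≤ 2 * a N) ∧
      ∃ α β : ℝ, Tendsto (fun N => (j N : ℝ) / N) atTop (𝓝 β) ∧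
        Tendsto (fun N => (a N : ℝ) / N) atTop (𝓝 α) ∧
        (Real.negMulLog β + Real.negMulLog (1 - β) - Real.negMulLog 1)
          - ((Real.negMulLog α + Real.negMulLog (u - α) - Real.negMulLog u)
          + (Real.negMulLog (β - α) + Real.negMulLog ((1 - u) - (β - α)) - Real.negMulLog (1 - u)))
          ≤ max (Real.binEntropy u - Real.binEntropy (u - t)) 0 := by
  have hkN : ∀ᶠ N in atTop, k N ≤ N := by
    filter_upwards [eventually_lt_of_tendsto_div hu1 hk tendsto_self_div] with N h
    exact_mod_cast h.le
  rcases le_or_gt (u - t) (1 - u) with hs | hs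
  · obtain ⟨s, hs_def⟩ : ∃ s, s = u - t := ⟨_, rfl⟩
    have hs0 : 0 ≤ s := by linarith
    have hts : t ≤ 1 - 2 * s := by linarith
    -- `β` is the input density for which a binary symmetric channel with flip probability `s` has
    -- output density `u`, and `α = β (1 - s)` is the joint density of ones. The rate is then the
    -- mutual information `H(u) - H(s)`. If `s = 1/2`, then `t = 0`, and the value `0 / 0 = 0` is a
    -- valid choice.
    set β := t / (1 - 2 * s) with hβ
    have hβ1 : β ≤ 1 := div_le_one_of_le₀ hts (by linarith)
    have hβ0 : 0 ≤ β := div_nonneg ht0 (by linarith)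
    have hβt : β * (1 - 2 * s) = t := by
      rcases eq_or_ne (1 - 2 * s) 0 with h | h
      · rw [h, mul_zero]; linarith
      · rw [hβ, div_mul_cancel₀ _ h]
    set α := β * (1 - s) with hα
    have hu : u = β * (1 - s) + (1 - β) * s := by linarith
    have hαt : t ≤ α := by nlinarith
    have hαu : α ≤ u := by nlinarith
    have hαs : α ≤ 1 + t - u := by nlinarith
    -- The clamps enforce the exact integer constraints for `j = 2 a - T`; none of them changes the
    -- limit `α`.
    set a : ℕ → ℕ := fun N => max (T N) (min ⌈α * N⌉₊ (min (k N) (N + T N - k N))) with ha_def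
    have h1 : Tendsto (fun N : ℕ => (⌈α * N⌉₊ : ℝ) / N) atTop (𝓝 α) := by
      refine tendsto_ceil_div (ht0.trans hαt) ?_
      have := tendsto_self_div.const_mul α
      rw [mul_one] at this
      exact this.congr fun N => by ring
    have hNT : Tendsto (fun N : ℕ => ((N + T N : ℕ) : ℝ) / N) atTop (𝓝 (1 + t)) :=
      (tendsto_self_div.add hT).congr fun N => by push_cast; ring
    have h2 : Tendsto (fun N : ℕ => ((N + T N - k N : ℕ) : ℝ) / N) atTop (𝓝 (1 + t - u)) :=
      tendsto_cast_sub_div (hkN.mono fun N h => by omega) hNT hk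
    have ha : Tendsto (fun N => (a N : ℝ) / N) atTop (𝓝 α) := by
      have := tendsto_cast_max_div hT (tendsto_cast_min_div h1 (tendsto_cast_min_div hk h2))
      rwa [min_eq_left (le_min hαu hαs), max_eq_right hαt] at this
    have haT : ∀ N, T N ≤ a N := fun N => le_max_left _ _
    have h2a : Tendsto (fun N : ℕ => ((2 * a N : ℕ) : ℝ) / N) atTop (𝓝 (2 * α)) :=
      (ha.const_mul 2).congr fun N => by push_cast; ring
    refine ⟨fun N => 2 * a N - T N, a, ?_, α, β, ?_, ha, ?_⟩
    · filter_upwards [hkN] with N hN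
      have h3 := haT N
      have h4 : a N ≤ k N := max_le (hTk N) ((min_le_right _ _).trans (min_le_left _ _))
      have h5 : a N ≤ N + T N - k N :=
        max_le (by omega) ((min_le_right _ _).trans (min_le_right _ _))
      omega
    · have := tendsto_cast_sub_div (Eventually.of_forall fun N => by have := haT N; omega) h2a hT
      rwa [show 2 * α - t = β by rw [hα, ← hβt]; ring] at this
    · refine le_trans (le_of_eq ?_) (le_max_left _ _)
      rw [← hs_def, show u - α = (1 - β) * s by rw [hu, hα]; ring,
        show β - α = β * s by rw [hα]; ring,
        show 1 - u - β * s = (1 - β) * (1 - s) by rw [hu]; ring, hα,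
        Real.binEntropy_eq_negMulLog_add_negMulLog_one_sub,
        Real.binEntropy_eq_negMulLog_add_negMulLog_one_sub, Real.negMulLog_mul,
        Real.negMulLog_mul, Real.negMulLog_mul, Real.negMulLog_mul, Real.negMulLog_one]
      ring
  -- For `s > 1 - u` the single pattern without erasures is enough, at rate zero.
  · refine ⟨fun N => N, k, ?_, u, 1, tendsto_self_div, hk, ?_⟩
    · have h2k : Tendsto (fun N : ℕ => (2 * k N : ℝ) / N) atTop (𝓝 (2 * u)) :=
        (hk.const_mul 2).congr fun N => by ring
      have hNT : Tendsto (fun N : ℕ => ((N : ℝ) + T N) / N) atTop (𝓝 (1 + t)) :=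
        (tendsto_self_div.add hT).congr fun N => by ring
      filter_upwards [hkN, eventually_lt_of_tendsto_div (by linarith) hNT h2k] with N h1 h2
      have h3 : N + T N < 2 * k N := by exact_mod_cast h2
      omega
    · refine le_trans (le_of_eq ?_) (le_max_right _ _)
      simp

lemma exists_cover_sequence {t u : ℝ} (ht0 : 0 ≤ t) (htu : t ≤ u) (hu1 : u < 1) {k T : ℕ → ℕ}
    (hk : Tendsto (fun N => (k N : ℝ) / N) atTop (𝓝 u))
    (hT : Tendsto (fun N => (T N : ℝ) / N) atTop (𝓝 t)) (hTk : ∀ N, T N ≤ k N)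
    {Dth : ℕ → ℝ} (hDT : ∀ N : ℕ, (N : ℝ) - Dth N ≤ T N) :
    ∃ B : ∀ N : ℕ, Finset (Fin N → Fin 2),
      (∀ᶠ N in atTop, ∀ s ∈ uncovered (B N) (Dth N), s.card < k N) ∧
      ∀ ε : ℝ, 0 < ε → ∀ᶠ N : ℕ in atTop,
        ((B N).card : ℝ) ≤ (2 : ℝ) ^ ((N : ℝ) * (max (H u - H (u - t)) 0 + ε)) := by
  obtain ⟨j, a, hja, α, β, hj, ha, hL⟩ := exists_overlap_parameters ht0 htu hu1 hk hT hTk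
  have hlog2 : 0 < Real.log 2 := Real.log_pos one_lt_two
  set L := (Real.negMulLog β + Real.negMulLog (1 - β) - Real.negMulLog 1)
          - ((Real.negMulLog α + Real.negMulLog (u - α) - Real.negMulLog u)
          + (Real.negMulLog (β - α) + Real.negMulLog ((1 - u) - (β - α)) - Real.negMulLog (1 - u)))
  set R := max (H u - H (u - t)) 0 with hR
  have hRL : max (Real.binEntropy u - Real.binEntropy (u - t)) 0 = R * Real.log 2 := by
    rw [hR, H_eq_binEntropy_div, H_eq_binEntropy_div, ← sub_div, max_mul_of_nonneg _ _ hlog2.le,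
      div_mul_cancel₀ _ hlog2.ne', zero_mul]
  rw [hRL] at hL
  have hR0 : 0 ≤ R := le_max_right _ _
  have hkN : ∀ᶠ N in atTop, k N ≤ N := by
    filter_upwards [eventually_lt_of_tendsto_div hu1 hk tendsto_self_div] with N h
    exact_mod_cast h.le
  have hlim : Tendsto (fun N => Real.log (N.choose (j N)) / N
      - (Real.log ((k N).choose (a N)) / N + Real.log ((N - k N).choose (j N - a N)) / N))
      atTop (𝓝 L) := by
    refine (tendsto_log_choose_div ?_ ?_ tendsto_self_div hj).sub
      ((tendsto_log_choose_div ?_ ?_ hk ha).add (tendsto_log_choose_div ?_ ?_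
        (tendsto_cast_sub_div hkN tendsto_self_div hk)
        (tendsto_cast_sub_div ?_ hj ha)))
    · exact hja.mono fun N h => h.1
    · exact Eventually.of_forall fun N => le_rfl
    · exact hja.mono fun N h => h.2.1
    · exact hkN
    · exact hja.mono fun N h => h.2.2.2.1
    · exact Eventually.of_forall fun N => Nat.sub_le _ _
    · exact hja.mono fun N h => h.2.2.1
  have hex : ∀ N, ∃ B : Finset (Fin N → Fin 2), 0 < N → (j N ≤ N ∧ a N ≤ k N ∧ a N ≤ j N ∧
      j N - a N ≤ N - k N ∧ j N + T N ≤ 2 * a N) →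
      (B.card : ℝ) ≤ N * ((N.choose (j N) : ℝ) / ((k N).choose (a N) *
        (N - k N).choose (j N - a N))) + 1 ∧
      ∀ s ∈ uncovered B (Dth N), s.card < k N := by
    intro N
    by_cases h : 0 < N ∧ (j N ≤ N ∧ a N ≤ k N ∧ a N ≤ j N ∧
      j N - a N ≤ N - k N ∧ j N + T N ≤ 2 * a N)
    · obtain ⟨hN, h1, h2, h3, h4, h5⟩ := h
      have h6 : (j N : ℝ) + T N ≤ 2 * a N := by exact_mod_cast h5
      obtain ⟨B, hB⟩ := exists_pattern_cover (D := Dth N) hN h1 h2 h3 h4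
        (by linarith [hDT N])
      exact ⟨B, fun _ _ => hB⟩
    -- The parameters are admissible only for large `N`; elsewhere any set will do.
    · exact ⟨∅, fun hN h' => absurd ⟨hN, h'⟩ h⟩
  choose B hB using hex
  refine ⟨B, ?_, ?_⟩
  · filter_upwards [eventually_gt_atTop 0, hja] with N hN h
    exact (hB N hN h).2
  · intro ε hε
    -- One half of `ε` absorbs the convergence of the binomial ratio, the other the polynomial
    -- factor `N + 1`.
    have hev := hlim.eventually_lt_const
      (show L < (R + ε / 2) * Real.log 2 by nlinarith)
    filter_upwards [eventually_gt_atTop 0, hja, hev,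
      eventually_two_mul_add_one_le (half_pos hε)] with N hN h h1 h2
    have hN' : (0 : ℝ) < N := by exact_mod_cast hN
    have c1 : (0 : ℝ) < N.choose (j N) := by exact_mod_cast Nat.choose_pos h.1
    have c2 : (0 : ℝ) < (k N).choose (a N) := by exact_mod_cast Nat.choose_pos h.2.1
    have c3 : (0 : ℝ) < (N - k N).choose (j N - a N) := by
      exact_mod_cast Nat.choose_pos h.2.2.2.1
    have hratio : (N.choose (j N) : ℝ) / ((k N).choose (a N) * (N - k N).choose (j N - a N)) ≤
        (2 : ℝ) ^ ((N : ℝ) * (R + ε / 2)) := by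
      rw [← Real.log_le_log_iff (by positivity) (by positivity), Real.log_div c1.ne'
        (by positivity), Real.log_mul c2.ne' c3.ne', Real.log_rpow two_pos]
      rw [← add_div, ← sub_div, div_lt_iff₀ hN'] at h1
      linarith
    have hone : (1 : ℝ) ≤ (2 : ℝ) ^ ((N : ℝ) * (R + ε / 2)) :=
      Real.one_le_rpow one_le_two (by positivity)
    calc ((B N).card : ℝ) ≤ _ := (hB N hN h).1
      _ ≤ N * (2 : ℝ) ^ ((N : ℝ) * (R + ε / 2)) + (2 : ℝ) ^ ((N : ℝ) * (R + ε / 2)) := by gcongr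
      _ = (N + 1) * (2 : ℝ) ^ ((N : ℝ) * (R + ε / 2)) := by ring
      _ ≤ (2 : ℝ) ^ ((N : ℝ) * (ε / 2)) * (2 : ℝ) ^ ((N : ℝ) * (R + ε / 2)) := by
          gcongr; linarith
      _ = _ := by rw [← Real.rpow_add two_pos]; ring_nf

lemma tendsto_rpow_three_quarters_div :
    Tendsto (fun N : ℕ => (N : ℝ) ^ (3 / 4 : ℝ) / N) atTop (𝓝 0) := by
  have h := (tendsto_rpow_neg_atTop (show (0 : ℝ) < 1 / 4 by norm_num)).comp
    tendsto_natCast_atTop_atTop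
  refine h.congr' ?_
  filter_upwards [eventually_gt_atTop 0] with N hN
  have hN' : (0 : ℝ) < N := by exact_mod_cast hN
  nth_rewrite 2 [← Real.rpow_one (N : ℝ)]
  rw [Function.comp_apply, ← Real.rpow_sub hN']
  norm_num

theorem exists_achieving_patterns
    (A : ℕ → Type*) [∀ N, Fintype (A N)] [∀ N, DecidableEq (A N)] [∀ N, Nontrivial (A N)]
    {p : ℝ} (hp0 : 0 < p) (hp1 : p < 1)
    (hpm : ∀ N, (1 - p) / ((Fintype.card (A N) : ℝ) - 1) < p)
    {Dth : ℕ → ℝ} {D : ℝ}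
    (hDth : Tendsto (fun N : ℕ => Dth N / (N : ℝ)) atTop (𝓝 D))
    (hD0 : 1 - p < D) (hD1 : D ≤ 1)
    {E : ℝ} (hE : E ∈ Set.Icc 0 (klBin (1 - D) p)) :
    ∃ B : ∀ N : ℕ, Finset (Fin N → Fin 2),
      (∀ c : ∀ N : ℕ, Fin N → A N,
        AchievesExponent (fun N => errorProb p (c N) (B N) (Dth N)) E) ∧
      ∀ ε : ℝ, 0 < ε → ∀ᶠ N : ℕ in atTop,
        ((B N).card : ℝ) ≤ (2 : ℝ) ^ ((N : ℝ) * (rate D p E + ε)) := by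
  obtain ⟨hut, hup⟩ := gInv_mem hp0 hp1 hD0 hD1 hE
  have hgu := klBin_gInv hp0 hp1 hD0 hD1 hE
  rw [rate]
  set u := gInv D p E
  have hu0 : 0 ≤ u := by linarith
  set T : ℕ → ℕ := fun N => ⌈(N : ℝ) - Dth N⌉₊ with hT_def
  -- The shift `N ^ (3/4)` is `o(N)`, so it costs no rate, but it exceeds the standard deviation of
  -- order `√N`, so the tail vanishes even when `u = p`.
  set w : ℕ → ℝ := fun N => u * N - (N : ℝ) ^ (3 / 4 : ℝ) with hw_def
  have hsub : Tendsto (fun N : ℕ => ((N : ℝ) - Dth N) / N) atTop (𝓝 (1 - D)) :=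
    (tendsto_self_div.sub hDth).congr fun N => by ring
  have hT : Tendsto (fun N => (T N : ℝ) / N) atTop (𝓝 (1 - D)) :=
    tendsto_ceil_div (by linarith) hsub
  have hw : Tendsto (fun N => w N / N) atTop (𝓝 u) := by
    have := (tendsto_self_div.const_mul u).sub tendsto_rpow_three_quarters_div
    rw [mul_one, sub_zero] at this
    exact this.congr fun N => by rw [hw_def]; ring
  have hk : Tendsto (fun N => ((max (T N) ⌈w N⌉₊ : ℕ) : ℝ) / N) atTop (𝓝 u) := by
    have := tendsto_cast_max_div hT (tendsto_ceil_div hu0 hw)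
    rwa [max_eq_right hut] at this
  obtain ⟨B, hBk, hBcard⟩ := exists_cover_sequence (by linarith) hut (by linarith) hk hT
    (fun N => le_max_left _ _) (Dth := Dth) fun N => Nat.le_ceil _
  refine ⟨B, fun c => ?_, by rwa [show u + D - 1 = u - (1 - D) by ring]⟩
  have hnonneg : ∀ N, 0 ≤ errorProb p (c N) (B N) (Dth N) :=
    fun N => errorProb_nonneg hp0 hp1 (hpm N) _ _ _
  rcases hup.lt_or_eq with hlt | heq
  · have hexp : ∀ ε : ℝ, 0 < ε → ∀ᶠ N : ℕ in atTop,
        errorProb p (c N) (B N) (Dth N) ≤ (2 : ℝ) ^ (-((N : ℝ) * (E - ε))) := by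
      intro ε hε
      -- Chernoff is applied at some `v > u`: the cut-off `k / N` only converges to `u`, and `u` may
      -- be `0`, which `sum_binomial_le` excludes.
      have hcont := ((klBin_continuous hp0 hp1).tendsto u).eventually_const_lt
        (show E - ε < klBin u p by linarith)
      obtain ⟨v, ⟨hv, hvu⟩, hvp⟩ := ((hcont.filter_mono nhdsWithin_le_nhds).and
        (self_mem_nhdsWithin : Set.Ioi u ∈ 𝓝[>] u) |>.and
        ((eventually_le_nhds hlt).filter_mono nhdsWithin_le_nhds)).exists
      have hv0 : 0 < v := hu0.trans_lt hvu
      filter_upwards [hBk, hk.eventually_lt_const hvu, eventually_gt_atTop 0] with N h1 h2 hN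
      have hN' : (0 : ℝ) < N := by exact_mod_cast hN
      rw [div_lt_iff₀ hN'] at h2
      refine (errorProb_le_of_cover hp0 hp1 (hpm N) _ _ _ (fun k : ℕ => (k : ℝ) ≤ v * N)
        fun s hs => ?_).trans ((sum_binomial_le hp1 hv0 hvp N).trans ?_)
      · have h3 : (s.card : ℝ) < ((max (T N) ⌈w N⌉₊ : ℕ) : ℝ) := by exact_mod_cast h1 s hs
        linarith
      · refine Real.rpow_le_rpow_of_exponent_le one_le_two ?_
        exact neg_le_neg (mul_le_mul_of_nonneg_left hv.le hN'.le)
    refine ⟨?_, hexp⟩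
    have hEpos : 0 < E := by
      rw [← hgu, ← klBin_self hp0 hp1]
      exact klBin_strictAntiOn hp0 hp1 ⟨hu0, hup⟩ ⟨hp0.le, le_rfl⟩ hlt
    have hz : Tendsto (fun N : ℕ => ((2 : ℝ) ^ (-(E - E / 2))) ^ N) atTop (𝓝 0) :=
      tendsto_pow_atTop_nhds_zero_of_lt_one (by positivity)
        (Real.rpow_lt_one_of_one_lt_of_neg one_lt_two (by linarith))
    refine tendsto_of_tendsto_of_tendsto_of_le_of_le' tendsto_const_nhds hz
      (Eventually.of_forall hnonneg) ?_
    filter_upwards [hexp (E / 2) (half_pos hEpos)] with N h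
    refine h.trans (le_of_eq ?_)
    rw [← Real.rpow_natCast, ← Real.rpow_mul two_pos.le]
    ring_nf
  · have hE0 : E = 0 := by rw [← hgu, heq, klBin_self hp0 hp1]
    have hz : Tendsto (fun N : ℕ => (p * (1 - p)) * (N : ℝ) ^ (-(1 / 2) : ℝ)) atTop
        (𝓝 (p * (1 - p) * 0)) :=
      ((tendsto_rpow_neg_atTop (show (0 : ℝ) < 1 / 2 by norm_num)).comp
        tendsto_natCast_atTop_atTop).const_mul _
    rw [mul_zero] at hz
    have hlim : Tendsto (fun N => errorProb p (c N) (B N) (Dth N)) atTop (𝓝 0) := by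
      refine tendsto_of_tendsto_of_tendsto_of_le_of_le' tendsto_const_nhds hz
        (Eventually.of_forall hnonneg) ?_
      filter_upwards [hBk, eventually_lt_of_tendsto_div (by linarith) hT hw,
        eventually_gt_atTop 0] with N h1 h2 hN
      have hN' : (0 : ℝ) < N := by exact_mod_cast hN
      have hpow : 0 < (N : ℝ) ^ (3 / 4 : ℝ) := by positivity
      refine (errorProb_le_of_cover hp0 hp1 (hpm N) _ _ _
        (fun k : ℕ => (N : ℝ) ^ (3 / 4 : ℝ) ≤ |N * p - k|)
        fun s hs => ?_).trans ((sum_binomial_far_le hp0.le hp1.le N hpow).trans (le_of_eq ?_))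
      -- Here `1 - D < p = u`, so eventually `T N` is not the larger term of the maximum.
      · have h3 : s.card < ⌈w N⌉₊ := by
          rcases lt_max_iff.1 (h1 s hs) with h | h
          · exact h.trans (Nat.lt_ceil.2 h2)
          · exact h
        have h4 := Nat.lt_ceil.1 h3
        simp only [hw_def, heq] at h4
        exact le_trans (by linarith) (le_abs_self _)
      · rw [← Real.rpow_natCast, ← Real.rpow_mul hN'.le, mul_comm (N : ℝ), mul_div_assoc]
        congr 1
        nth_rewrite 1 [← Real.rpow_one (N : ℝ)]
        rw [← Real.rpow_sub hN']
        norm_num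
    refine ⟨hlim, fun ε hε => ?_⟩
    filter_upwards [hlim.eventually_lt_const one_pos] with N h
    refine h.le.trans (Real.one_le_rpow one_le_two ?_)
    rw [hE0]
    have : 0 ≤ (N : ℝ) * ε := by positivity
    linarith

/-! ### The converse -/

lemma two_rpow_entropy_le_choose {N k : ℕ} (hN : 0 < N) (hk : k ≤ N) :
    (2 : ℝ) ^ ((N : ℝ) * H ((k : ℝ) / N)) ≤ ((N : ℝ) + 1) * N.choose k := by
  have hN' : (0 : ℝ) < N := by exact_mod_cast hN
  have hlog2 : 0 < Real.log 2 := Real.log_pos one_lt_two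
  have hc : (0 : ℝ) < N.choose k := by exact_mod_cast Nat.choose_pos hk
  obtain ⟨l, hl⟩ := Nat.exists_eq_add_of_le hk
  have h := le_log_choose k l
  rw [← hl, mul_log_scale hN' (N : ℝ), mul_log_scale hN' (k : ℝ), mul_log_scale hN' (l : ℝ),
    div_self hN'.ne', Real.negMulLog_one] at h
  have hl' : (N : ℝ) = k + l := by exact_mod_cast hl
  have e : (l : ℝ) / N = 1 - (k : ℝ) / N := by field_simp; linarith
  rw [← Real.log_le_log_iff (by positivity) (by positivity), Real.log_rpow two_pos,
    Real.log_mul (by positivity) hc.ne', H_eq_binEntropy_div, mul_assoc,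
    div_mul_cancel₀ _ hlog2.ne', Real.binEntropy_eq_negMulLog_add_negMulLog_one_sub, ← e]
  have e2 : (N : ℝ) * Real.log N = k * Real.log N + l * Real.log N := by rw [← add_mul, ← hl']
  linarith

lemma two_rpow_neg_klBin_le {p : ℝ} (h0 : 0 < p) (h1 : p < 1) {N k : ℕ} (hN : 0 < N)
    (hk : k ≤ N) :
    (2 : ℝ) ^ (-((N : ℝ) * klBin ((k : ℝ) / N) p)) ≤
      ((N : ℝ) + 1) * (N.choose k * (p ^ k * (1 - p) ^ (N - k))) := by
  have hN' : (0 : ℝ) < N := by exact_mod_cast hN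
  have hlog2 : 0 < Real.log 2 := Real.log_pos one_lt_two
  have h1p : 0 < 1 - p := by linarith
  have e : (2 : ℝ) ^ (-((N : ℝ) * klBin ((k : ℝ) / N) p)) =
      (2 : ℝ) ^ ((N : ℝ) * H ((k : ℝ) / N)) * (p ^ k * (1 - p) ^ (N - k)) := by
    refine Real.log_injOn_pos (Set.mem_Ioi.2 (by positivity)) (Set.mem_Ioi.2 (by positivity)) ?_
    rw [Real.log_rpow two_pos, Real.log_mul (by positivity) (by positivity),
      Real.log_rpow two_pos, Real.log_mul (by positivity) (by positivity), Real.log_pow,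
      Real.log_pow, klBin_eq_neg_binEntropy h0 h1, H_eq_binEntropy_div, Nat.cast_sub hk]
    field_simp
    ring
  rw [e, ← mul_assoc ((N : ℝ) + 1)]
  exact mul_le_mul_of_nonneg_right (two_rpow_entropy_le_choose hN hk) (by positivity)

/-- A positive rate forces the radius below `1/2`, since entropy decreases on `[1/2, 1]`; the ball
bound needs this. -/
lemma lt_half_of_entropy_lt {u s : ℝ} (hsu : s ≤ u) (hu1 : u ≤ 1) (h : H s < H u) : s < 1 / 2 := by
  by_contra! hs
  rw [one_div] at hs
  have h2 := Real.binEntropy_strictAntiOn.antitoneOn ⟨hs, hsu.trans hu1⟩ ⟨hs.trans hsu, hu1⟩ hsu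
  rw [H_eq_binEntropy_div, H_eq_binEntropy_div] at h
  exact absurd h (not_lt.2 (div_le_div_of_nonneg_right h2 (Real.log_pos one_lt_two).le))

/-- With fewer than `2 ^ (N (R - ε))` patterns, at least half of every weight shell close to `u`
stays uncovered. -/
lemma exists_half_uncovered {u D ε : ℝ} (hs0 : 0 ≤ u + D - 1) (hsu : u + D - 1 ≤ u) (hu1 : u ≤ 1)
    (hR : H (u + D - 1) < H u) (hε : 0 < ε) {Dth : ℕ → ℝ}
    (hDth : Tendsto (fun N : ℕ => Dth N / (N : ℝ)) atTop (𝓝 D)) :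
    ∃ δ > 0, ∀ᶠ N : ℕ in atTop, ∀ B : Finset (Fin N → Fin 2),
      (B.card : ℝ) < (2 : ℝ) ^ ((N : ℝ) * (H u - H (u + D - 1) - ε)) →
      ∀ k ≤ N, |(k : ℝ) / N - u| ≤ δ →
        (N.choose k : ℝ) / 2 ≤ ((uncovered B (Dth N)).filter fun s => s.card = k).card := by
  set s := u + D - 1 with hs_def
  have hs := lt_half_of_entropy_lt hsu hu1 hR
  have hε4 : 0 < ε / 4 := by positivity
  obtain ⟨δ₁, hδ₁, h₁⟩ := Metric.continuous_iff.1 H_continuous u (ε / 4) hε4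
  obtain ⟨δ₂, hδ₂, h₂⟩ := Metric.continuous_iff.1 H_continuous s (ε / 4) hε4
  obtain ⟨δ, hδ, hδm⟩ := exists_between
    (show 0 < min δ₁ (min (δ₂ / 2) ((1 / 2 - s) / 2)) by
      refine lt_min hδ₁ (lt_min (by positivity) (by linarith)))
  rw [lt_min_iff, lt_min_iff] at hδm
  refine ⟨δ, hδ, ?_⟩
  -- The radius is enlarged by one `δ` for `k / N` and one for `Dth N / N`. Of the loss `ε`, a
  -- quarter goes to each of the two entropies at most, and half to the factor `2 (N + 1)`.
  have hv := h₂ (s + 2 * δ) (by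
    rw [Real.dist_eq, add_sub_cancel_left, abs_of_pos (by positivity)]; linarith)
  rw [Real.dist_eq] at hv
  filter_upwards [hDth.eventually_lt_const (show D < D + δ by linarith), eventually_gt_atTop 0,
    eventually_two_mul_add_one_le (half_pos hε)] with N hDN hN hpoly B hB k hkN hk
  have hN' : (0 : ℝ) < N := by exact_mod_cast hN
  have hHk := h₁ ((k : ℝ) / N) (by rw [Real.dist_eq]; linarith)
  rw [Real.dist_eq] at hHk
  rw [div_lt_iff₀ hN'] at hDN
  have hkle : (k : ℝ) ≤ (u + δ) * N := by
    rw [← div_le_iff₀ hN']; linarith [le_abs_self ((k : ℝ) / N - u)]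
  have hunc := choose_sub_le_card_uncovered (v := s + 2 * δ) (by linarith) (by linarith) B
    (D := Dth N) (k := k) (by nlinarith)
  refine le_trans ?_ hunc
  have hmain : 2 * (B.card * (2 : ℝ) ^ ((N : ℝ) * H (s + 2 * δ))) * (N + 1) ≤
      (N + 1) * N.choose k := by
    calc 2 * (B.card * (2 : ℝ) ^ ((N : ℝ) * H (s + 2 * δ))) * (N + 1)
        = B.card * ((2 : ℝ) ^ ((N : ℝ) * H (s + 2 * δ)) * (2 * (N + 1))) := by ring
      _ ≤ (2 : ℝ) ^ ((N : ℝ) * (H u - H s - ε)) * ((2 : ℝ) ^ ((N : ℝ) * H (s + 2 * δ)) *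
          (2 : ℝ) ^ ((N : ℝ) * (ε / 2))) := by gcongr
      _ = (2 : ℝ) ^ ((N : ℝ) * (H u - H s - ε + H (s + 2 * δ) + ε / 2)) := by
          rw [← Real.rpow_add two_pos, ← Real.rpow_add two_pos]; ring_nf
      _ ≤ (2 : ℝ) ^ ((N : ℝ) * H ((k : ℝ) / N)) := by
          refine Real.rpow_le_rpow_of_exponent_le one_le_two ?_
          refine mul_le_mul_of_nonneg_left ?_ hN'.le
          linarith [(abs_lt.1 hv).2, (abs_lt.1 hHk).1]
      _ ≤ _ := two_rpow_entropy_le_choose hN hkN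
  have := le_of_mul_le_mul_left (by linarith : ((N : ℝ) + 1) *
    (2 * (B.card * (2 : ℝ) ^ ((N : ℝ) * H (s + 2 * δ)))) ≤ (N + 1) * N.choose k) (by positivity)
  linarith

/-- The binomial distribution concentrates around its mean. -/
lemma eventually_half_le_sum_binomial {p δ : ℝ} (h0 : 0 < p) (h1 : p < 1) (hδ : 0 < δ) :
    ∀ᶠ N : ℕ in atTop, 1 / 2 ≤
      ∑ k ∈ (Finset.range (N + 1)).filter (fun k : ℕ => |(k : ℝ) / N - p| ≤ δ),
        (N.choose k : ℝ) * (p ^ k * (1 - p) ^ (N - k)) := by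
  have h1p : 0 < 1 - p := by linarith
  have hlim : Tendsto (fun N : ℕ => p * (1 - p) / δ ^ 2 * (1 / (N : ℝ))) atTop
      (𝓝 (p * (1 - p) / δ ^ 2 * 0)) := tendsto_one_div_atTop_nhds_zero_nat.const_mul _
  rw [mul_zero] at hlim
  filter_upwards [hlim.eventually_lt_const (show (0 : ℝ) < 1 / 2 by norm_num),
    eventually_gt_atTop 0] with N h hN
  have hN' : (0 : ℝ) < N := by exact_mod_cast hN
  have hfar := sum_binomial_far_le h0.le h1.le N (mul_pos hN' hδ)
  have e : (N : ℝ) * (p * (1 - p)) / (N * δ) ^ 2 = p * (1 - p) / δ ^ 2 * (1 / (N : ℝ)) := by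
    field_simp
  rw [e] at hfar
  have htot : ∑ k ∈ Finset.range (N + 1), (N.choose k : ℝ) * (p ^ k * (1 - p) ^ (N - k)) = 1 := by
    calc _ = (p + (1 - p)) ^ N := by
          rw [add_pow]; exact Finset.sum_congr rfl fun k _ => by ring
      _ = 1 := by simp
  rw [← Finset.sum_filter_add_sum_filter_not _ (fun k : ℕ => |(k : ℝ) / N - p| ≤ δ)] at htot
  have hle : ∑ k ∈ (Finset.range (N + 1)).filter (fun k : ℕ => ¬ |(k : ℝ) / N - p| ≤ δ),
      (N.choose k : ℝ) * (p ^ k * (1 - p) ^ (N - k)) ≤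
      ∑ k ∈ (Finset.range (N + 1)).filter (fun k : ℕ => N * δ ≤ |N * p - k|),
      (N.choose k : ℝ) * (p ^ k * (1 - p) ^ (N - k)) := by
    refine Finset.sum_le_sum_of_subset_of_nonneg ?_ fun k _ _ => by positivity
    intro k hk
    rw [Finset.mem_filter] at hk ⊢
    refine ⟨hk.1, ?_⟩
    have e2 : (N : ℝ) * p - k = N * -((k : ℝ) / N - p) := by field_simp; ring
    rw [e2, abs_mul, abs_neg, abs_of_pos hN']
    exact mul_le_mul_of_nonneg_left (not_le.1 hk.2).le hN'.le
  linarith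

theorem card_ge_of_achievesExponent
    (A : ℕ → Type*) [∀ N, Fintype (A N)] [∀ N, DecidableEq (A N)] [∀ N, Nontrivial (A N)]
    {p : ℝ} (hp0 : 0 < p) (hp1 : p < 1)
    (hpm : ∀ N, (1 - p) / ((Fintype.card (A N) : ℝ) - 1) < p)
    {Dth : ℕ → ℝ} {D : ℝ}
    (hDth : Tendsto (fun N : ℕ => Dth N / (N : ℝ)) atTop (𝓝 D))
    (hD0 : 1 - p < D) (hD1 : D ≤ 1)
    {E : ℝ} (hE : E ∈ Set.Icc 0 (klBin (1 - D) p))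
    (B : ∀ N : ℕ, Finset (Fin N → Fin 2)) (c : ∀ N : ℕ, Fin N → A N)
    (hach : AchievesExponent (fun N => errorProb p (c N) (B N) (Dth N)) E) {ε : ℝ} (hε : 0 < ε) :
    ∀ᶠ N : ℕ in atTop, (2 : ℝ) ^ ((N : ℝ) * (rate D p E - ε)) ≤ ((B N).card : ℝ) := by
  obtain ⟨hut, hup⟩ := gInv_mem hp0 hp1 hD0 hD1 hE
  have hgu := klBin_gInv hp0 hp1 hD0 hD1 hE
  rw [rate]
  set u := gInv D p E
  have hu0 : 0 ≤ u := by linarith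
  obtain ⟨hlim, hexp⟩ := hach
  rcases le_or_gt (H u - H (u + D - 1)) 0 with hR | hR
  · rw [max_eq_right hR]
    -- At rate zero it is enough that `B N` is nonempty, and the empty set has error probability
    -- `1`.
    filter_upwards [hlim.eventually_lt_const one_pos] with N h
    have hne : (B N).Nonempty := by
      by_contra hemp
      rw [Finset.not_nonempty_iff_eq_empty] at hemp
      rw [hemp, errorProb_empty (hpm N)] at h
      exact lt_irrefl _ h
    have h1 : (1 : ℝ) ≤ (B N).card := by exact_mod_cast hne.card_pos
    refine le_trans (Real.rpow_le_one_of_one_le_of_nonpos one_le_two ?_) h1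
    have : 0 ≤ (N : ℝ) * ε := by positivity
    linarith
  · rw [max_eq_left hR.le]
    obtain ⟨δ, hδ, hhalf⟩ := exists_half_uncovered (by linarith) (by linarith) (by linarith)
      (sub_pos.1 hR) hε hDth
    rcases hup.lt_or_eq with hlt | heq
    · obtain ⟨v, huv, hv⟩ := exists_between (show u < min (u + δ) p from lt_min (by linarith) hlt)
      rw [lt_min_iff] at hv
      have hvE : klBin v p < E := by
        rw [← hgu]
        exact klBin_strictAntiOn hp0 hp1 ⟨hu0, hup⟩ ⟨by linarith, hv.2.le⟩ huv
      -- One `η` is the slack in the assumed exponent, one pays for `2 (N + 1)`, and the third makes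
      -- the final comparison of exponents contradictory.
      obtain ⟨η, hη, hη2⟩ : ∃ η > 0, klBin v p < E - 3 * η :=
        ⟨(E - klBin v p) / 4, by linarith, by linarith⟩
      have hk : Tendsto (fun N : ℕ => (⌈v * N⌉₊ : ℝ) / N) atTop (𝓝 v) := by
        refine tendsto_ceil_div (by linarith) ?_
        have := tendsto_self_div.const_mul v
        rw [mul_one] at this
        exact this.congr fun N => by ring
      have hkl := (((klBin_continuous hp0 hp1).tendsto v).comp hk).eventually_lt_const hη2
      filter_upwards [hhalf, hexp η hη, hkl, hk.eventually_lt_const hv.1,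
        hk.eventually_const_lt huv, hk.eventually_lt_const (show v < 1 by linarith),
        eventually_gt_atTop 0, eventually_two_mul_add_one_le hη] with N h1 h2 h3 h4 h5 h6 hN h7
      have hN' : (0 : ℝ) < N := by exact_mod_cast hN
      by_contra! hcard
      rw [div_lt_one hN'] at h6
      have hkN : ⌈v * N⌉₊ ≤ N := by exact_mod_cast h6.le
      have h8 := le_errorProb_of_uncovered hp0 hp1 (hpm N) (c N) (B N) (Dth N) {⌈v * N⌉₊}
        (fun k hk => by
          rw [Finset.mem_singleton] at hk
          subst hk
          exact h1 (B N) hcard _ hkN (abs_le.2 ⟨by linarith, by linarith⟩))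
      rw [Finset.sum_singleton] at h8
      have h9 := two_rpow_neg_klBin_le hp0 hp1 hN hkN
      simp only [Function.comp_apply] at h3
      have h10 : (2 : ℝ) ^ (-((N : ℝ) * (E - 3 * η))) ≤
          (2 : ℝ) ^ (-((N : ℝ) * klBin ((⌈v * N⌉₊ : ℝ) / N) p)) :=
        Real.rpow_le_rpow_of_exponent_le one_le_two
          (neg_le_neg (mul_le_mul_of_nonneg_left h3.le hN'.le))
      have h11 : (2 : ℝ) ^ (-((N : ℝ) * (E - 3 * η))) ≤ (2 : ℝ) ^ (-((N : ℝ) * (E - 2 * η))) := by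
        calc _ ≤ _ := h10
          _ ≤ _ := h9
          _ ≤ ((N : ℝ) + 1) * (2 * (2 : ℝ) ^ (-((N : ℝ) * (E - η)))) := by
              refine mul_le_mul_of_nonneg_left ?_ (by positivity)
              linarith
          _ = (2 * ((N : ℝ) + 1)) * (2 : ℝ) ^ (-((N : ℝ) * (E - η))) := by ring
          _ ≤ (2 : ℝ) ^ ((N : ℝ) * η) * (2 : ℝ) ^ (-((N : ℝ) * (E - η))) := by gcongr
          _ = _ := by rw [← Real.rpow_add two_pos]; ring_nf
      rw [Real.rpow_le_rpow_left_iff one_lt_two] at h11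
      nlinarith
    -- With `E = 0` the exponent says nothing, so the contradiction is with convergence to `0`: half
    -- of shells of total mass at least `1/2` is uncovered.
    · rw [heq] at hhalf
      filter_upwards [hhalf, eventually_half_le_sum_binomial hp0 hp1 hδ,
        hlim.eventually_lt_const (show (0 : ℝ) < 1 / 4 by norm_num)] with N h1 h2 h3
      by_contra! hcard
      rw [heq] at hcard
      have h4 := le_errorProb_of_uncovered hp0 hp1 (hpm N) (c N) (B N) (Dth N)
        ((Finset.range (N + 1)).filter (fun k : ℕ => |(k : ℝ) / N - p| ≤ δ))
        (fun k hk => by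
          rw [Finset.mem_filter, Finset.mem_range, Nat.lt_succ_iff] at hk
          exact h1 (B N) hcard k hk.1 hk.2)
      linarith

end MBM

end

theorem theorem2
    -- the field `𝔽_m`, which may grow with the block length `N`
    (A : ℕ → Type*) [∀ N, Field (A N)] [∀ N, Fintype (A N)] [∀ N, DecidableEq (A N)]
    (p : ℝ) (hp1 : p < 1)
    (hpm : ∀ N, (1 - p) / ((Fintype.card (A N) : ℝ) - 1) < p)
    -- distortion threshold `Dth N` at block length `N`, and its value `D` per symbol
    (Dth : ℕ → ℝ) (D : ℝ)
    (hDth : Tendsto (fun N : ℕ => Dth N / (N : ℝ)) atTop (𝓝 D))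
    (hD0 : 1 - p < D) (hD1 : D ≤ 1)
    -- exponent per symbol
    (E : ℝ) (hE : E ∈ Set.Icc 0 (MBM.klBin (1 - D) p)) :
    Set.BijOn (fun u => MBM.klBin u p) (Set.Icc (1 - D) p)
      (Set.Icc 0 (MBM.klBin (1 - D) p)) ∧
    -- `2 ^ (N R)` attempts suffice
    (∃ B : ∀ N : ℕ, Finset (Fin N → Fin 2),
      (∀ c : ∀ N : ℕ, Fin N → A N,
        MBM.AchievesExponent (fun N => MBM.errorProb p (c N) (B N) (Dth N)) E) ∧
      ∀ ε : ℝ, 0 < ε → ∀ᶠ N : ℕ in atTop,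
        ((B N).card : ℝ) ≤ (2 : ℝ) ^ ((N : ℝ) * (MBM.rate D p E + ε))) ∧
    -- and fewer do not
    (∀ (B : ∀ N : ℕ, Finset (Fin N → Fin 2)) (c : ∀ N : ℕ, Fin N → A N),
      MBM.AchievesExponent (fun N => MBM.errorProb p (c N) (B N) (Dth N)) E →
      ∀ ε : ℝ, 0 < ε → ∀ᶠ N : ℕ in atTop,
        (2 : ℝ) ^ ((N : ℝ) * (MBM.rate D p E - ε)) ≤ ((B N).card : ℝ)) := by
  -- Positivity of `p` follows because a field has at least two elements and `(1 - p) / (m - 1)` is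
  -- therefore positive.
  have hp0 : 0 < p := by
    have hcard : (1 : ℝ) < Fintype.card (A 0) := by exact_mod_cast Fintype.one_lt_card
    exact (div_pos (by linarith) (by linarith)).trans (hpm 0)
  exact ⟨MBM.klBin_bijOn hp0 hp1 hD0 hD1,
    MBM.exists_achieving_patterns A hp0 hp1 hpm hDth hD0 hD1 hE,
    fun B c hach ε hε =>
      MBM.card_ge_of_achievesExponent A hp0 hp1 hpm hDth hD0 hD1 hE B c hach hε⟩
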